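/- Let $\mathbf K$ be a commutative ring and let $\mathcal G$ be a $\mathbf K$-linear Grothendieck category. Let $\mathcal A$ be a full subcategory of $\mathcal G$ whose objects form a small set of generators of $\mathcal G$. Let $\mathcal M=\mathrm{Mod}(\mathcal A)$ be the abelian category of $\mathbf K$-linear functors $\mathcal A^{\mathrm{op}}\to \mathrm{Mod}(\mathbf K)$, let $S\colon\mathcal G\to\mathcal M$ be the functor $S(C)(A)=\mathcal G(A,C)$, let $T\colon\mathcal M\to\mathcal G$ be its left adjoint (which exists), and let $\mathcal N=\ker T$ be the full subcategory of those $M\in\mathcal M$ with $T(M)\cong 0$. Let $D_{\mathcal N}(\mathcal M)$ be the full subcategory of the derived category $D(\mathcal M)$ of unbounded complexes consisting of the objects all of whose cohomology objects lie in $\mathcal N$. Assume (membership in $\mathcal A$ being understood up to isomorphism): \begin{enumerate} \item $\mathcal A$ is closed under finite coproducts in $\mathcal G$; \item every object of $\mathcal A$ is a noetherian object of $\mathcal G$; \item if $f\colon A'\to A$ is an epimorphism of $\mathcal G$ with $A,A'\in\mathcal A$, then $\ker f\in\mathcal A$; \item for every $A\in\mathcal A$ there is an integer $N(A)>0$ such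 that $D(\mathcal G)(A,A'[N(A)])=0$ for every $A'\in\mathcal A$. \end{enumerate} Call an object $P$ of $D(\mathcal M)$ compact if every morphism from $P$ to a coproduct $\coprod_{i\in I}X_i$ in $D(\mathcal M)$ indexed by a small set $I$ factors through $\coprod_{i\in J}X_i$ for some finite subset $J\subseteq I$. Then the objects of $D_{\mathcal N}(\mathcal M)$ that are compact in $D(\mathcal M)$ satisfy the following condition (G1) in $D_{\mathcal N}(\mathcal M)$: an object $X$ of $D_{\mathcal N}(\mathcal M)$ is isomorphic to $0$ if and only if every morphism $P\to X[j]$ is zero, for every $P\in D_{\mathcal N}(\mathcal M)$ that is compact in $D(\mathcal M)$ and every $j\in\mathbb Z$. -/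

import Mathlib

open CategoryTheory CategoryTheory.Limits

universe w w' k v u

noncomputable section

namespace CptGen

section Modules

variable (K : Type k) [CommRing K] (C : Type w) [Category.{v} C] [Preadditive C] [Linear K C]

/-- The property of being a `K`-linear functor `Cᵒᵖ ⥤ ModuleCat K`. -/
def isLinearPresheaf : ObjectProperty (Cᵒᵖ ⥤ ModuleCat.{v} K) := fun F =>
  F.Additive ∧ ∀ ⦃X Y : C⦄ (r : K) (f : X ⟶ Y), F.map (r • f).op = r • F.map f.op

/-- The category `Mod(C)` of right `C`-modules, i.e. of `K`-linear functors
`Cᵒᵖ ⥤ ModuleCat K`. -/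
abbrev LinMod : Type _ := (isLinearPresheaf K C).FullSubcategory

variable {K C}

lemma isLinearPresheaf_of_jointlyMono {ι : Type*} {F : Cᵒᵖ ⥤ ModuleCat.{v} K}
    (H : ι → Cᵒᵖ ⥤ ModuleCat.{v} K) (i : ∀ j, F ⟶ H j)
    (hi : ∀ (X : Cᵒᵖ) (Z : ModuleCat.{v} K) (a b : Z ⟶ F.obj X),
      (∀ j, a ≫ (i j).app X = b ≫ (i j).app X) → a = b)
    (h : ∀ j, isLinearPresheaf K C (H j)) :
    isLinearPresheaf K C F := by
  refine ⟨⟨fun {X Y f g} => hi _ _ _ _ fun j => ?_⟩, fun X Y r f => hi _ _ _ _ fun j => ?_⟩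
  · have := (h j).1
    rw [(i j).naturality, Preadditive.add_comp, (i j).naturality, (i j).naturality,
      (H j).map_add, Preadditive.comp_add]
  · rw [(i j).naturality, Linear.smul_comp, (i j).naturality, (h j).2, Linear.comp_smul]

lemma isLinearPresheaf_of_epi {F H : Cᵒᵖ ⥤ ModuleCat.{v} K} (p : H ⟶ F) [Epi p]
    (h : isLinearPresheaf K C H) : isLinearPresheaf K C F := by
  have hp (X : Cᵒᵖ) : Epi (p.app X) := inferInstance
  have := h.1
  refine ⟨⟨fun {X Y f g} => ?_⟩, fun X Y r f => ?_⟩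
  · rw [← cancel_epi (p.app X), ← p.naturality, Preadditive.comp_add, ← p.naturality,
      ← p.naturality, H.map_add, Preadditive.add_comp]
  · rw [← cancel_epi (p.app _), ← p.naturality, Linear.comp_smul, ← p.naturality, h.2,
      Linear.smul_comp]

instance : (isLinearPresheaf K C).IsClosedUnderKernels where
  kernels_le := by
    rintro _ ⟨f, c, hc, hf, -⟩
    have : Mono (Fork.ι c) := mono_of_isLimit_fork hc
    refine isLinearPresheaf_of_jointlyMono (fun _ : Unit => _) (fun _ => Fork.ι c) ?_ (fun _ => hf)
    intro X Z a b hab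
    have : Mono ((Fork.ι c).app X) := inferInstance
    exact (cancel_mono ((Fork.ι c).app X)).1 (hab ())

instance : (isLinearPresheaf K C).IsClosedUnderCokernels where
  cokernels_le := by
    rintro _ ⟨f, c, hc, -, hf⟩
    have : Epi (Cofork.π c) := epi_of_isColimit_cofork hc
    exact isLinearPresheaf_of_epi (Cofork.π c) hf

instance : (isLinearPresheaf K C).IsClosedUnderFiniteProducts :=
  .of_isClosedUnderLimitsOfShape fun n _ => ⟨by
    rintro F ⟨p⟩
    refine isLinearPresheaf_of_jointlyMono (fun j : Discrete n => p.diag.obj j)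
      (fun j => p.π.app j) ?_ (fun j => p.prop_diag_obj j)
    intro X Z a b hab
    exact (isLimitOfPreserves ((evaluation _ _).obj X) p.isLimit).hom_ext hab⟩

instance : (isLinearPresheaf K C).ContainsZero where
  exists_zero := by
    obtain ⟨Z, hZ⟩ := HasZeroObject.zero (C := Cᵒᵖ ⥤ ModuleCat.{v} K)
    refine ⟨Z, hZ, isLinearPresheaf_of_jointlyMono (fun j : Empty => j.elim) (fun j => j.elim)
      ?_ (fun j => j.elim)⟩
    intro X W a b _
    exact (((evaluation _ _).obj X).map_isZero hZ).eq_of_tgt a b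

end Modules

section

variable (K : Type k) [CommRing K] {G : Type u} [Category.{v} G] [Abelian G] [Linear K G]
  {ι : Type v} (A : ι → G)

/-- The functor `S : G ⥤ Mod(A)`, `S(C)(A) = G(A, C)`, where `A` is the full subcategory of `G`
on the objects `A i`. -/
def restrictedYoneda : G ⥤ LinMod K (InducedCategory G A) :=
  (isLinearPresheaf K (InducedCategory G A)).lift
    (linearYoneda K G ⋙ (Functor.whiskeringLeft _ _ _).obj (inducedFunctor A).op)
    (fun X => ⟨⟨by intros; ext x; exact Preadditive.add_comp _ _ _ _ _ x⟩,
      fun _ _ r f => by ext x; exact Linear.smul_comp _ _ _ r f.hom x⟩)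

instance : PreservesLimits (restrictedYoneda K A) := by
  suffices PreservesLimits (restrictedYoneda K A ⋙ (isLinearPresheaf K _).ι) from
    preservesLimits_of_reflects_of_preserves _ (isLinearPresheaf K (InducedCategory G A)).ι
  refine ⟨fun {J} _ => preservesLimitsOfShape_of_evaluation _ _ fun X => ?_⟩
  suffices PreservesLimitsOfShape J ((linearCoyoneda K G).obj (Opposite.op (A X.unop))) from this
  suffices PreservesLimitsOfShape J ((linearCoyoneda K G).obj (Opposite.op (A X.unop)) ⋙
      forget (ModuleCat.{v} K)) from
    preservesLimitsOfShape_of_reflects_of_preserves _ (forget (ModuleCat.{v} K))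
  exact inferInstanceAs (PreservesLimitsOfShape J (coyoneda.obj (Opposite.op (A X.unop))))

instance [IsGrothendieckAbelian.{v} G] : (restrictedYoneda K A).IsRightAdjoint :=
  isRightAdjoint_of_preservesLimits_of_isCoseparating
    (isCoseparator_coseparator G) _

/-- The functor `T : Mod(A) ⥤ G`, left adjoint to `S`. -/
def leftAdj [IsGrothendieckAbelian.{v} G] : LinMod K (InducedCategory G A) ⥤ G :=
  (restrictedYoneda K A).leftAdjoint

/-- The kernel of `T`: the modules `M` such that `T(M) = 0`. -/
def torsion [IsGrothendieckAbelian.{v} G] : ObjectProperty (LinMod K (InducedCategory G A)) :=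
  (leftAdj K A).kernel

instance [IsGrothendieckAbelian.{v} G] : (torsion K A).IsClosedUnderIsomorphisms :=
  inferInstanceAs (leftAdj K A).kernel.IsClosedUnderIsomorphisms

end

section Derived

variable {M : Type*} [Category* M] [Abelian M] [HasDerivedCategory.{w} M]

/-- The objects of `D(M)` all of whose cohomology objects belong to `N`. -/
def derivedWithCohomologyIn (N : ObjectProperty M) : ObjectProperty (DerivedCategory M) :=
  fun X => ∀ n : ℤ, N ((DerivedCategory.homologyFunctor M n).obj X)

instance (N : ObjectProperty M) [N.IsClosedUnderIsomorphisms] :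
    (derivedWithCohomologyIn N).IsStableUnderShift ℤ where
  isStableUnderShiftBy a :=
    { le_shift := fun X hX n => N.prop_of_iso
        (((DerivedCategory.homologyFunctor M 0).shiftIso a n (a + n) rfl).symm.app X)
        (hX (a + n)) }

end Derived

section Triangulated

variable {T : Type*} [Category* T]

/-- An object `P` is compact if every morphism from `P` to a coproduct indexed by a small set `I`
factors through the subcoproduct indexed by some finite subset of `I`. -/
def IsCompactObject [HasFiniteCoproducts T] (P : T) : Prop :=
  ∀ (I : Type v) (X : I → T) (c : Cofan X) (_ : IsColimit c) (f : P ⟶ c.pt),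
    ∃ (J : Finset I) (g : P ⟶ ∐ fun j : J => X j), g ≫ Sigma.desc (fun j => c.inj j) = f

/-- Condition (G1): an object `X` is zero if and only if there are no nonzero morphisms from objects
of `S` to shifts of `X`. -/
def SatisfiesG1 [HasZeroMorphisms T] [HasShift T ℤ] (S : ObjectProperty T) : Prop :=
  ∀ X : T, IsZero X ↔ ∀ P : T, S P → ∀ (j : ℤ) (f : P ⟶ (shiftFunctor T j).obj X), f = 0

end Triangulated

end CptGen

end

/-! The main point is that every morphism x : S(A i) → X in D(M), with X having torsion cohomology,
factors through a compact object with torsion cohomology. If all morphisms from such objects to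
shifts of X vanish, then so do all S(A i) → X[n]. The S(A i) are projective generators of Mod(A), so
these morphisms detect the cohomology of X, and X = 0.

The factorization is controlled by an obstruction κ in Ext^{n+1}_G(A i, A k), available for every n
(`exists_obstruction`): whenever f : A l → A i kills κ, the restriction of x along f factors as
wanted. As X has torsion cohomology, x dies on some epimorphism p : A a → A i (`torsion_iff`), whose
kernel is some A k. For n = 0 the class of this extension is the obstruction, since an f killing it
lifts through p. For larger n, x extends over the cone of S(p); restriction to S(A k)[1] gives a
morphism S(A k) → X[-1], which has an obstruction one degree lower, and its Yoneda product with the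
extension class is the obstruction for x.

If f kills this product, effaceability of Ext yields an epimorphism q : A b → A l with kernel A r
and a map A r → A k killing the lower obstruction
(`IsNoetherianGenerating.exists_lift_of_comp_singleδ_eq_zero`). The resulting factorization on S(A
r)[1] is pushed out along S(A r)[1] → cone S(q). The third term, coker S(q), is torsion and compact
in D(M), so both properties survive (`factorsThruSmall_of_square`). In degree N(A i) the obstruction
is zero and f can be the identity. -/

noncomputable section

namespace CptGen

open Opposite

/-! ### Small objects of preadditive and triangulated categories. -/

section Compact

variable {T : Type*} [Category* T] [Preadditive T]

/-- Every morphism from `P` to a coproduct is a finite sum of morphisms to the summands. -/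
def IsSmallObject (P : T) : Prop :=
  ∀ (I : Type v) (X : I → T) (c : Cofan X) (_ : IsColimit c) (f : P ⟶ c.pt),
    ∃ (J : Finset I) (g : ∀ i, P ⟶ X i), f = ∑ i ∈ J, g i ≫ c.inj i

lemma IsSmallObject.isCompactObject [HasFiniteCoproducts T] {P : T} (h : IsSmallObject.{v} P) :
    IsCompactObject.{v} P := by
  intro I X c hc f
  obtain ⟨J, g, rfl⟩ := h I X c hc f
  refine ⟨J, ∑ j : J, g j ≫ Sigma.ι (fun j : J => X j) j, ?_⟩
  rw [Preadditive.sum_comp, ← Finset.sum_coe_sort J]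
  exact Finset.sum_congr rfl fun j _ => by simp

open Classical in
/-- The projection of a coproduct onto the summands indexed by a finite set. -/
def cofanProj {I : Type v} {X : I → T} {c : Cofan X} (hc : IsColimit c) (J : Finset I) :
    c.pt ⟶ c.pt :=
  Cofan.IsColimit.desc hc fun i => if i ∈ J then c.inj i else 0

lemma inj_cofanProj {I : Type v} {X : I → T} {c : Cofan X} (hc : IsColimit c) {J : Finset I}
    {i : I} (hi : i ∈ J) : c.inj i ≫ cofanProj hc J = c.inj i := by
  simp [cofanProj, hi]

open Classical in
lemma cofanProj_eq_sum {I : Type v} {X : I → T} {c : Cofan X} (hc : IsColimit c) (J : Finset I) :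
    cofanProj hc J = ∑ i ∈ J, Cofan.IsColimit.desc hc
      (fun k => if h : k = i then eqToHom (by rw [h]) else 0) ≫ c.inj i := by
  refine Cofan.IsColimit.hom_ext hc _ _ fun k => ?_
  rw [Preadditive.comp_sum]
  simp only [cofanProj, Cofan.IsColimit.fac, Cofan.IsColimit.fac_assoc]
  split_ifs with hk
  · rw [Finset.sum_eq_single_of_mem k hk]
    · simp
    · intro b _ hb
      rw [dif_neg (Ne.symm hb), zero_comp]
  · refine (Finset.sum_eq_zero fun b hb => ?_).symm
    rw [dif_neg (by rintro rfl; exact hk hb), zero_comp]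

/-- Being fixed by an endomorphism of the coproduct is stable under enlarging `J`, and it needs no
other coproduct to exist; this is the form suited to triangles. -/
lemma isSmallObject_iff (P : T) : IsSmallObject.{v} P ↔
    ∀ (I : Type v) (X : I → T) (c : Cofan X) (hc : IsColimit c) (f : P ⟶ c.pt),
      ∃ J : Finset I, f ≫ cofanProj hc J = f := by
  refine ⟨fun h I X c hc f => ?_, fun h I X c hc f => ?_⟩
  · obtain ⟨J, g, rfl⟩ := h I X c hc f
    refine ⟨J, ?_⟩
    rw [Preadditive.sum_comp]
    exact Finset.sum_congr rfl fun j hj => by rw [Category.assoc, inj_cofanProj hc hj]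
  · classical
    obtain ⟨J, hJ⟩ := h I X c hc f
    refine ⟨J, fun i => f ≫ Cofan.IsColimit.desc hc
      (fun k => if h : k = i then eqToHom (by rw [h]) else 0), hJ.symm.trans ?_⟩
    rw [cofanProj_eq_sum, Preadditive.comp_sum]
    simp only [Category.assoc]

lemma cofanProj_comp {I : Type v} {X : I → T} {c : Cofan X} (hc : IsColimit c) {J J' : Finset I}
    (h : J ⊆ J') : cofanProj hc J ≫ cofanProj hc J' = cofanProj hc J := by
  rw [cofanProj_eq_sum hc J, Preadditive.sum_comp]
  exact Finset.sum_congr rfl fun j hj => by rw [Category.assoc, inj_cofanProj hc (h hj)]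

lemma IsSmallObject.of_isZero {P : T} (h : IsZero P) : IsSmallObject.{v} P :=
  fun _ _ _ _ _ => ⟨∅, fun _ => 0, h.eq_of_src _ _⟩

lemma IsSmallObject.obj_of_adjunction {T' : Type*} [Category* T'] [Preadditive T'] {F : T ⥤ T'}
    {R : T' ⥤ T} (adj : F ⊣ R) [F.Additive] [PreservesColimitsOfSize.{v, v} R] {P : T}
    (h : IsSmallObject.{v} P) : IsSmallObject.{v} (F.obj P) := by
  intro I X c hc f
  have hc' : IsColimit (Cofan.mk c.pt c.inj) := IsColimit.ofIsoColimit hc (Cofan.ext (Iso.refl _))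
  obtain ⟨J, g, hg⟩ := h I (fun i => R.obj (X i)) _
    (isColimitCofanMkObjOfIsColimit R X _ hc') (adj.homEquiv _ _ f)
  refine ⟨J, fun i => (adj.homEquiv _ _).symm (g i), (adj.homEquiv _ _).injective ?_⟩
  rw [hg]
  simp only [Adjunction.homEquiv_counit]
  rw [← (adj.homEquiv _ _).symm.injective.eq_iff, Equiv.symm_apply_apply,
    Adjunction.homEquiv_counit]
  simp [Preadditive.sum_comp]

variable [HasShift T ℤ] [∀ n : ℤ, (shiftFunctor T n).Additive]

lemma IsSmallObject.shift {P : T} (h : IsSmallObject.{v} P) (n : ℤ) : IsSmallObject.{v} (P⟦n⟧) :=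
  have : (shiftEquiv T n).functor.Additive := inferInstanceAs (shiftFunctor T n).Additive
  h.obj_of_adjunction (shiftEquiv T n).toAdjunction

variable [HasZeroObject T] [Pretriangulated T]

lemma IsSmallObject.ext₃ {t : Pretriangulated.Triangle T}
    (ht : t ∈ Pretriangulated.distinguishedTriangles)
    (h₁ : IsSmallObject.{v} t.obj₁) (h₂ : IsSmallObject.{v} t.obj₂) : IsSmallObject.{v} t.obj₃ := by
  classical
  have h₁' := h₁.shift 1
  rw [isSmallObject_iff] at h₁' h₂ ⊢
  intro I X c hc f
  obtain ⟨J, hJ⟩ := h₂ I X c hc (t.mor₂ ≫ f)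
  -- The part of `f` outside `J` dies on `t.obj₂`, so it comes from the shift of `t.obj₁`, where
  -- smallness supplies a second finite set.
  obtain ⟨h, hh⟩ := Pretriangulated.Triangle.yoneda_exact₃ t ht (f - f ≫ cofanProj hc J) (by
    rw [Preadditive.comp_sub, ← Category.assoc, hJ, sub_self])
  obtain ⟨J', hJ'⟩ := h₁' I X c hc h
  refine ⟨J ∪ J', ?_⟩
  have hf : f = t.mor₃ ≫ h ≫ cofanProj hc J' + f ≫ cofanProj hc J := by
    rw [hJ', ← hh, sub_add_cancel]
  rw [hf]
  simp only [Preadditive.add_comp, Category.assoc, cofanProj_comp hc Finset.subset_union_left,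
    cofanProj_comp hc Finset.subset_union_right]

lemma IsSmallObject.ext₂ {t : Pretriangulated.Triangle T}
    (ht : t ∈ Pretriangulated.distinguishedTriangles)
    (h₁ : IsSmallObject.{v} t.obj₁) (h₃ : IsSmallObject.{v} t.obj₃) : IsSmallObject.{v} t.obj₂ :=
  IsSmallObject.ext₃ (Pretriangulated.inv_rot_of_distTriang _ ht) (h₃.shift (-1)) h₁

end Compact

/-! ### Lifting, extension and weak pushouts along distinguished triangles. -/

section Triangulated
open Pretriangulated
variable {T : Type*} [Category* T] [Preadditive T] [HasZeroObject T] [HasShift T ℤ]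
  [∀ n : ℤ, (shiftFunctor T n).Additive] [Pretriangulated T]

variable {X Y Z W : T} {f : X ⟶ Y} {g : Y ⟶ Z} {h : Z ⟶ X⟦(1 : ℤ)⟧}

lemma exists_desc_of_distinguished (ht : Triangle.mk f g h ∈ distTriang T) (φ : Y ⟶ W)
    (hφ : f ≫ φ = 0) : ∃ ψ : Z ⟶ W, g ≫ ψ = φ := by
  obtain ⟨ψ, hψ⟩ := Triangle.yoneda_exact₂ _ ht φ hφ
  exact ⟨ψ, hψ.symm⟩

lemma exists_lift_of_distinguished (ht : Triangle.mk f g h ∈ distTriang T) (φ : W ⟶ Y)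
    (hφ : φ ≫ g = 0) : ∃ ψ : W ⟶ X, ψ ≫ f = φ := by
  obtain ⟨ψ, hψ⟩ := Triangle.coyoneda_exact₂ _ ht φ hφ
  exact ⟨ψ, hψ.symm⟩

lemma exists_lift_of_distinguished₃ (ht : Triangle.mk f g h ∈ distTriang T) (φ : W ⟶ Z)
    (hφ : φ ≫ h = 0) : ∃ ψ : W ⟶ Y, ψ ≫ g = φ := by
  obtain ⟨ψ, hψ⟩ := Triangle.coyoneda_exact₃ _ ht φ hφ
  exact ⟨ψ, hψ.symm⟩

lemma exists_extension_of_distinguished (ht : Triangle.mk f g h ∈ distTriang T) (φ : X ⟶ W)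
    (hφ : h ≫ φ⟦1⟧' = 0) : ∃ ψ : Y ⟶ W, f ≫ ψ = φ := by
  obtain ⟨ψ, hψ⟩ : ∃ ψ : Y⟦(1 : ℤ)⟧ ⟶ W⟦(1 : ℤ)⟧, φ⟦1⟧' = (-f⟦1⟧') ≫ ψ :=
    Triangle.yoneda_exact₂ _ (rot_of_distTriang _ (rot_of_distTriang _ ht)) (φ⟦1⟧') hφ
  obtain ⟨ψ, rfl⟩ := (shiftFunctor T (1 : ℤ)).map_surjective ψ
  exact ⟨-ψ, (shiftFunctor T (1 : ℤ)).map_injective (by simp [hψ])⟩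

lemma exists_weak_pushout (ht : Triangle.mk f g h ∈ distTriang T) {P : T}
    (u : X ⟶ P) (v : P ⟶ W) (y : Y ⟶ W) (hy : f ≫ y = u ≫ v) :
    ∃ (P' : T) (a : P ⟶ P') (b : P' ⟶ Z) (d : Y ⟶ P') (s : P' ⟶ W),
      Triangle.mk a b (h ≫ u⟦1⟧') ∈ distTriang T ∧ d ≫ s = y := by
  obtain ⟨P', a, b, hP'⟩ := distinguished_cocone_triangle₂ (h ≫ u⟦1⟧')
  obtain ⟨d, hd₁, hd₂⟩ : ∃ d : Y ⟶ P', f ≫ d = u ≫ a ∧ g ≫ 𝟙 Z = d ≫ b :=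
    complete_distinguished_triangle_morphism₂ _ _ ht hP' u (𝟙 _) (Category.id_comp _).symm
  obtain ⟨s, hs⟩ := exists_extension_of_distinguished hP' v (by
    have h0 : h ≫ f⟦1⟧' = 0 := comp_distTriang_mor_zero₃₁ _ ht
    rw [Category.assoc, ← Functor.map_comp, ← hy, Functor.map_comp, ← Category.assoc, h0,
      zero_comp])
  -- The error `y - d ≫ s` vanishes on `X`, so it factors through `Z`; since `g` is `d ≫ b`, adding
  -- `b ≫ r` to `s` absorbs it.
  obtain ⟨r, hr⟩ := exists_desc_of_distinguished ht (y - d ≫ s) (by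
    rw [Preadditive.comp_sub, hy, ← Category.assoc, hd₁, Category.assoc, hs, sub_self])
  refine ⟨P', a, b, d, s + b ≫ r, hP', ?_⟩
  rw [Preadditive.comp_add, ← Category.assoc, ← hd₂, Category.comp_id, hr]
  abel

end Triangulated

/-! ### Morphisms from a projective in one degree are points of cohomology. -/

section SingleProjective
open DerivedCategory HomologicalComplex

variable {C : Type*} [Category* C] [Abelian C]

lemma isKProjective_single (P : C) [Projective P] (n : ℤ) :
    CochainComplex.IsKProjective ((single C (ComplexShape.up ℤ) n).obj P) := by
  have (i : ℤ) : Projective (((single C (ComplexShape.up ℤ) n).obj P).X i) := by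
    by_cases hi : i = n
    · subst hi
      exact Projective.of_iso (singleObjXSelf _ _ P).symm inferInstance
    · have := isZero_single_obj_X (ComplexShape.up ℤ) n P i hi
      exact Projective.of_iso this.isoZero.symm inferInstance
  have : CochainComplex.IsStrictlyLE ((single C (ComplexShape.up ℤ) n).obj P) n :=
    inferInstance
  exact CochainComplex.isKProjective_of_projective _ n

/-- A morphism from a single complex which is a boundary is homotopic to zero. -/
def homotopyZeroOfSingle {P : C} {n : ℤ} {Y : CochainComplex C ℤ}
    (z : (single C (ComplexShape.up ℤ) n).obj P ⟶ Y) (y : P ⟶ Y.X (n - 1))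
    (hy : z.f n = (singleObjXSelf _ n P).hom ≫ y ≫ Y.d (n - 1) n) : Homotopy z 0 :=
  let h : ∀ i j : ℤ, (ComplexShape.up ℤ).Rel j i →
      (((single C (ComplexShape.up ℤ) n).obj P).X i ⟶ Y.X j) := fun i j r =>
    if hi : i = n then (singleObjXIsoOfEq _ n P i hi).hom ≫ y ≫
      (Y.XIsoOfEq (by subst hi; simp at r; omega)).hom else 0
  (Homotopy.ofEq (by
    ext
    rw [Homotopy.nullHomotopicMap'_f (show (ComplexShape.up ℤ).Rel (n - 1) n by simp)
      (show (ComplexShape.up ℤ).Rel n (n + 1) by simp)]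
    simp [h, hy, singleObjXSelf])).trans (Homotopy.nullHomotopy' h)

variable [HasDerivedCategory.{w} C]

/-- The morphism in the derived category induced by a morphism from a single complex. -/
def singleToQ {P : C} {n : ℤ} {Y : CochainComplex C ℤ}
    (z : (single C (ComplexShape.up ℤ) n).obj P ⟶ Y) : (singleFunctor C n).obj P ⟶ Q.obj Y :=
  Q.map z

lemma singleToQ_comp {P : C} {n : ℤ} {Y Y' : CochainComplex C ℤ}
    (z : (single C (ComplexShape.up ℤ) n).obj P ⟶ Y) (g : Y ⟶ Y') :
    singleToQ (z ≫ g) = singleToQ z ≫ Q.map g :=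
  Q.map_comp _ _

lemma singleToQ_eq_zero {P : C} {n : ℤ} {Y : CochainComplex C ℤ}
    (z : (single C (ComplexShape.up ℤ) n).obj P ⟶ Y) (h : Homotopy z 0) : singleToQ z = 0 :=
  (DerivedCategory.Q_map_eq_of_homotopy C h).trans (Q.map_zero _ _)

lemma exists_singleToQ_eq {P : C} [Projective P] {n : ℤ} {Y : CochainComplex C ℤ}
    (f : (singleFunctor C n).obj P ⟶ Q.obj Y) :
    ∃ z : (single C (ComplexShape.up ℤ) n).obj P ⟶ Y, singleToQ z = f := by
  have := isKProjective_single P n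
  obtain ⟨z, hz⟩ := (CochainComplex.IsKProjective.Qh_map_bijective
    ((single C (ComplexShape.up ℤ) n).obj P) ((HomotopyCategory.quotient _ _).obj Y)).2 f
  obtain ⟨z, rfl⟩ := (HomotopyCategory.quotient _ _).map_surjective z
  exact ⟨z, hz⟩

/-- The cohomology of the image of a complex in the derived category. -/
def homologyQIso (Y : CochainComplex C ℤ) (n : ℤ) :
    (homologyFunctor C n).obj (Q.obj Y) ≅ Y.homology n :=
  (homologyFunctorFactors C n).app Y

/-- The morphism to the cohomology induced by a morphism from a single complex. -/
def homologyPoint {P : C} {n : ℤ} {X : DerivedCategory C}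
    (f : (singleFunctor C n).obj P ⟶ X) : P ⟶ (homologyFunctor C n).obj X :=
  (singleFunctorCompHomologyFunctorIso C n).inv.app P ≫ (homologyFunctor C n).map f

lemma homologyPoint_comp {P : C} {n : ℤ} {X Y : DerivedCategory C}
    (f : (singleFunctor C n).obj P ⟶ X) (g : X ⟶ Y) :
    homologyPoint (f ≫ g) = homologyPoint f ≫ (homologyFunctor C n).map g := by
  simp [homologyPoint]

lemma homologyPoint_map_comp {P P' : C} {n : ℤ} {X : DerivedCategory C} (p : P' ⟶ P)
    (f : (singleFunctor C n).obj P ⟶ X) :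
    homologyPoint ((singleFunctor C n).map p ≫ f) = p ≫ homologyPoint f := by
  have := (singleFunctorCompHomologyFunctorIso C n).inv.naturality p
  dsimp at this
  simp [homologyPoint, reassoc_of% this]

lemma homologyPoint_zero {P : C} {n : ℤ} {X : DerivedCategory C} :
    homologyPoint (0 : (singleFunctor C n).obj P ⟶ X) = 0 := by
  simp [homologyPoint]

lemma homologyPoint_singleToQ {P : C} {n : ℤ} {Y : CochainComplex C ℤ}
    (z : (single C (ComplexShape.up ℤ) n).obj P ⟶ Y) :
    homologyPoint (singleToQ z) ≫ (homologyQIso Y n).hom =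
      (singleObjCyclesSelfIso _ n P).inv ≫ cyclesMap z n ≫ Y.homologyπ n := by
  have e : (singleFunctorCompHomologyFunctorIso C n).inv.app P =
      (singleObjHomologySelfIso _ n P).inv ≫
        (homologyQIso ((single C (ComplexShape.up ℤ) n).obj P) n).inv := by
    change (((homologyFunctorSingleIso C (ComplexShape.up ℤ) n).inv.app P ≫
      (homologyFunctorFactors C n).inv.app ((single C (ComplexShape.up ℤ) n).obj P)) ≫ 𝟙 _) ≫
        (homologyFunctor C n).map (((singleFunctorsPostcompQIso C).inv.hom n).app P) = _
    rw [singleFunctorsPostcompQIso_inv_hom]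
    exact (congrArg _ ((homologyFunctor C n).map_id _)).trans
      ((Category.comp_id _).trans (Category.comp_id _))
  have h := homologyFunctorFactors_hom_naturality z n
  have h' : (homologyQIso ((single C (ComplexShape.up ℤ) n).obj P) n).inv ≫
      (homologyFunctor C n).map (Q.map z) ≫ (homologyQIso Y n).hom = homologyMap z n := by
    rw [Iso.inv_comp_eq]; exact h
  have h'' : homologyPoint (singleToQ z) = (singleObjHomologySelfIso _ n P).inv ≫
        (homologyQIso ((single C (ComplexShape.up ℤ) n).obj P) n).inv ≫
          (homologyFunctor C n).map (Q.map z) :=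
    (congrArg (· ≫ (homologyFunctor C n).map (Q.map z)) e).trans (Category.assoc _ _ _)
  rw [h'', Category.assoc, Category.assoc, h', ← singleObjCyclesSelfIso_inv_homologyπ,
    Category.assoc, homologyπ_naturality]

lemma homologyPoint_injective {P : C} [Projective P] {n : ℤ} {X : DerivedCategory C}
    {f : (singleFunctor C n).obj P ⟶ X} (hf : homologyPoint f = 0) : f = 0 := by
  obtain ⟨Y, ⟨e⟩⟩ : ∃ Y : CochainComplex C ℤ, Nonempty (Q.obj Y ≅ X) :=
    ⟨_, ⟨Q.objObjPreimageIso X⟩⟩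
  rw [← cancel_mono e.inv, zero_comp]
  replace hf : homologyPoint (f ≫ e.inv) = 0 := by rw [homologyPoint_comp, hf, zero_comp]
  generalize f ≫ e.inv = g at hf ⊢
  obtain ⟨z, rfl⟩ := exists_singleToQ_eq g
  have hz := homologyPoint_singleToQ z
  rw [hf, zero_comp, eq_comm, ← Category.assoc] at hz
  have hz' : Y.liftCycles ((singleObjXSelf _ n P).inv ≫ z.f n) (n + 1) (by simp) (by simp) ≫
      Y.homologyπ n = 0 := by
    rw [← hz]
    congr 1
    rw [← cancel_mono (Y.iCycles n)]
    simp
  rw [Y.liftCycles_comp_homologyπ_eq_zero_iff_up_to_refinements (n - 1) n (n + 1) (by simp)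
    (by simp)] at hz'
  -- The cycle is a boundary only after the epimorphism `π`, which splits because `P` is projective.
  obtain ⟨A', π, _, y, hy⟩ := hz'
  have hy' : z.f n = (singleObjXSelf _ n P).hom ≫ (Projective.factorThru (𝟙 P) π ≫ y) ≫
      Y.d (n - 1) n := by
    rw [Category.assoc, ← hy, Projective.factorThru_comp_assoc]
    simp
  exact singleToQ_eq_zero z (homotopyZeroOfSingle z _ hy')

lemma homologyPoint_surjective {P : C} [Projective P] {n : ℤ} {X : DerivedCategory C}
    (x : P ⟶ (homologyFunctor C n).obj X) :
    ∃ f : (singleFunctor C n).obj P ⟶ X, homologyPoint f = x := by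
  obtain ⟨Y, ⟨e⟩⟩ : ∃ Y : CochainComplex C ℤ, Nonempty (Q.obj Y ≅ X) :=
    ⟨_, ⟨Q.objObjPreimageIso X⟩⟩
  let x' : P ⟶ Y.homology n :=
    x ≫ (homologyFunctor C n).map e.inv ≫ (homologyQIso Y n).hom
  let c := Projective.factorThru x' (Y.homologyπ n)
  let z : (single C (ComplexShape.up ℤ) n).obj P ⟶ Y :=
    mkHomFromSingle (c ≫ Y.iCycles n) (by simp)
  refine ⟨singleToQ z ≫ e.hom, ?_⟩
  have hz := homologyPoint_singleToQ z
  have hc : (singleObjCyclesSelfIso _ n P).inv ≫ cyclesMap z n = c := by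
    rw [← cancel_mono (Y.iCycles n)]
    simp [z]
  rw [reassoc_of% hc, Projective.factorThru_comp, ← Iso.eq_comp_inv] at hz
  rw [homologyPoint_comp, hz]
  simp [x', ← Functor.map_comp]

end SingleProjective

/-! ### Small projective generators remain small in the derived category. -/

section SmallSingle
open DerivedCategory HomologicalComplex

variable {C : Type*} [Category* C] [Abelian C]

lemma mono_of_points {ι : Type*} (P : ι → C)
    (hsep : ∀ ⦃X Y : C⦄ (f : X ⟶ Y), (∀ i (x : P i ⟶ X), x ≫ f = 0) → f = 0)
    {X Y : C} (f : X ⟶ Y) (h : ∀ i (x : P i ⟶ X), x ≫ f = 0 → x = 0) :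
    Mono f :=
  Preadditive.mono_of_cancel_zero _ fun g hg => hsep _ fun i x => h i _ (by simp [hg])

lemma epi_of_points {ι : Type*} (P : ι → C)
    (hsep : ∀ ⦃X Y : C⦄ (f : X ⟶ Y), (∀ i (x : P i ⟶ X), x ≫ f = 0) → f = 0)
    {X Y : C} (f : X ⟶ Y) (h : ∀ i (y : P i ⟶ Y), ∃ x, x ≫ f = y) : Epi f :=
  Preadditive.epi_of_cancel_zero _ fun g hg => hsep _ fun i y => by
    obtain ⟨x, rfl⟩ := h i y
    simp [hg]

variable [HasDerivedCategory.{w} C]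

/-- A morphism from the single complex is a chain map determined by its degree `n` component, to
which smallness in `C` applies. The coproduct here is one of complexes. -/
lemma exists_sum_of_single {P : C} [Projective P] (hP : IsSmallObject.{v} P) {n : ℤ} {I : Type v}
    [HasCoproducts.{v} C]
    {Y : I → CochainComplex C ℤ} {c : Cofan Y} (hc : IsColimit c)
    (f : (singleFunctor C n).obj P ⟶ Q.obj c.pt) :
    ∃ (J : Finset I) (g : ∀ i, (singleFunctor C n).obj P ⟶ Q.obj (Y i)),
      f = ∑ i ∈ J, g i ≫ Q.map (c.inj i) := by
  classical
  obtain ⟨z, rfl⟩ := exists_singleToQ_eq f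
  have hc' : IsColimit (Cofan.mk c.pt c.inj) := IsColimit.ofIsoColimit hc (Cofan.ext (Iso.refl _))
  obtain ⟨J, x, hx⟩ := hP I (fun i => (Y i).X n) _
    (isColimitCofanMkObjOfIsColimit (eval C (ComplexShape.up ℤ) n) Y _ hc')
    ((singleObjXSelf _ n P).inv ≫ z.f n)
  replace hx : (singleObjXSelf _ n P).inv ≫ z.f n = ∑ i ∈ J, x i ≫ (c.inj i).f n := hx
  have hz : z ≫ cofanProj hc J = z := by
    ext
    rw [← cancel_epi (singleObjXSelf _ n P).inv, comp_f, ← Category.assoc, hx,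
      Preadditive.sum_comp]
    refine Finset.sum_congr rfl fun i hi => ?_
    rw [Category.assoc]
    congr 1
    exact congr_hom (inj_cofanProj hc hi) n
  rw [cofanProj_eq_sum, Preadditive.comp_sum] at hz
  refine ⟨J, fun i => singleToQ (z ≫ Cofan.IsColimit.desc hc
      (fun k => if h : k = i then eqToHom (by rw [h]) else 0)), ?_⟩
  conv_lhs => rw [← hz]
  refine (Functor.map_sum Q _ _).trans (Finset.sum_congr rfl fun i _ => ?_)
  rw [← Category.assoc]
  exact singleToQ_comp _ _

variable {ι : Type*} (P : ι → C) [∀ i, Projective (P i)]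

lemma isIso_of_single_points
    (hsep : ∀ ⦃X Y : C⦄ (f : X ⟶ Y), (∀ i (x : P i ⟶ X), x ≫ f = 0) → f = 0)
    {X Y : DerivedCategory C} (f : X ⟶ Y)
    (hinj : ∀ n i (x : (singleFunctor C n).obj (P i) ⟶ X), x ≫ f = 0 → x = 0)
    (hsurj : ∀ n i (y : (singleFunctor C n).obj (P i) ⟶ Y), ∃ x, x ≫ f = y) : IsIso f := by
  rw [DerivedCategory.isIso_iff]
  intro n
  have : Mono ((homologyFunctor C n).map f) := mono_of_points P hsep _ fun i x hx => by
    obtain ⟨x, rfl⟩ := homologyPoint_surjective x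
    rw [← homologyPoint_comp] at hx
    rw [hinj n i x (homologyPoint_injective hx), homologyPoint_zero]
  have : Epi ((homologyFunctor C n).map f) := epi_of_points P hsep _ fun i y => by
    obtain ⟨y, rfl⟩ := homologyPoint_surjective y
    obtain ⟨x, rfl⟩ := hsurj n i y
    exact ⟨_, (homologyPoint_comp _ _).symm⟩
  exact isIso_of_mono_of_epi _

variable [HasCoproducts.{v} C]

/-- Coproducts of quasi-isomorphisms are quasi-isomorphisms: injectivity and surjectivity on points
are checked one summand at a time, by smallness. -/
lemma isIso_Q_map_of_cofan
    (hsep : ∀ ⦃X Y : C⦄ (f : X ⟶ Y), (∀ i (x : P i ⟶ X), x ≫ f = 0) → f = 0)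
    (hP : ∀ i, IsSmallObject.{v} (P i)) {I : Type v} {K L : I → CochainComplex C ℤ}
    (φ : ∀ i, K i ⟶ L i)
    (hφ : ∀ i, IsIso (Q.map (φ i))) {c : Cofan K} (hc : IsColimit c) {d : Cofan L}
    (hd : IsColimit d) (f : c.pt ⟶ d.pt) (hf : ∀ i, c.inj i ≫ f = φ i ≫ d.inj i) :
    IsIso (Q.map f) := by
  classical
  refine isIso_of_single_points P hsep _ (fun n i x hx => ?_) (fun n i y => ?_)
  · obtain ⟨J, g, rfl⟩ := exists_sum_of_single (hP i) hc x
    refine Finset.sum_eq_zero fun j hj => ?_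
    suffices g j = 0 by simp [this]
    rw [← cancel_mono (Q.map (φ j)), zero_comp]
    have := hx =≫ Q.map (Cofan.IsColimit.desc hd
      (fun k => if h : k = j then eqToHom (by rw [h]) else 0))
    rw [zero_comp, Preadditive.sum_comp, Preadditive.sum_comp] at this
    rw [← this, Finset.sum_eq_single_of_mem j hj]
    · simp only [Category.assoc, ← Q.map_comp, reassoc_of% hf]
      simp
    · intro b _ hb
      simp only [Category.assoc, ← Q.map_comp, reassoc_of% hf]
      simp [hb]
  · obtain ⟨J, g, rfl⟩ := exists_sum_of_single (hP i) hd y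
    refine ⟨∑ j ∈ J, g j ≫ inv (Q.map (φ j)) ≫ Q.map (c.inj j), ?_⟩
    rw [Preadditive.sum_comp]
    refine Finset.sum_congr rfl fun j _ => ?_
    simp only [Category.assoc, ← Q.map_comp, hf]
    simp

/-- The morphisms are written as roofs and the coproduct of the roofs is taken. Uniqueness is not
needed to transfer smallness. -/
lemma exists_Q_desc
    (hsep : ∀ ⦃X Y : C⦄ (f : X ⟶ Y), (∀ i (x : P i ⟶ X), x ≫ f = 0) → f = 0)
    (hP : ∀ i, IsSmallObject.{v} (P i)) {I : Type v} {K : I → CochainComplex C ℤ}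
    {c : Cofan K} (hc : IsColimit c)
    {X : DerivedCategory C} (φ : ∀ i, Q.obj (K i) ⟶ X) :
    ∃ θ : Q.obj c.pt ⟶ X, ∀ i, Q.map (c.inj i) ≫ θ = φ i := by
  obtain ⟨Y, ⟨e⟩⟩ : ∃ Y : CochainComplex C ℤ, Nonempty (Q.obj Y ≅ X) :=
    ⟨_, ⟨Q.objObjPreimageIso X⟩⟩
  choose K' s hs g hg using fun i => right_fac (φ i ≫ e.inv)
  let t : ∐ K' ⟶ c.pt := Sigma.desc fun i => s i ≫ c.inj i
  have ht (i : I) : Sigma.ι K' i ≫ t = s i ≫ c.inj i := by simp [t]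
  have : IsIso (Q.map t) := isIso_Q_map_of_cofan P hsep hP s hs (coproductIsCoproduct K') hc t ht
  refine ⟨inv (Q.map t) ≫ Q.map (Sigma.desc g) ≫ e.hom, fun i => ?_⟩
  have : Q.map (c.inj i) ≫ inv (Q.map t) = inv (Q.map (s i)) ≫ Q.map (Sigma.ι K' i) := by
    rw [IsIso.comp_inv_eq, Category.assoc, ← Q.map_comp, ht, Q.map_comp, IsIso.inv_hom_id_assoc]
  rw [reassoc_of% this, ← Q.map_comp_assoc, Sigma.ι_desc, ← Category.assoc, ← hg]
  simp

lemma isSmallObject_singleFunctor_obj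
    (hsep : ∀ ⦃X Y : C⦄ (f : X ⟶ Y), (∀ i (x : P i ⟶ X), x ≫ f = 0) → f = 0)
    (hP : ∀ i, IsSmallObject.{v} (P i)) (n : ℤ) (i : ι) :
    IsSmallObject.{v} ((singleFunctor C n).obj (P i)) := by
  intro I X c hc f
  obtain ⟨Y, ⟨e⟩⟩ : ∃ Y : I → CochainComplex C ℤ, Nonempty (∀ i, Q.obj (Y i) ≅ X i) :=
    ⟨_, ⟨fun i => Q.objObjPreimageIso (X i)⟩⟩
  obtain ⟨θ, hθ⟩ := exists_Q_desc P hsep hP (coproductIsCoproduct Y)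
    (fun i => (e i).hom ≫ c.inj i)
  -- This makes the given coproduct a retract of the image of a coproduct of complexes.
  let σ : c.pt ⟶ Q.obj (∐ Y) := Cofan.IsColimit.desc hc fun i => (e i).inv ≫ Q.map (Sigma.ι Y i)
  have hσ : σ ≫ θ = 𝟙 _ := Cofan.IsColimit.hom_ext hc _ _ fun i => by
    have := hθ i
    dsimp at this
    simp [σ, this]
  obtain ⟨J, g, hg⟩ := exists_sum_of_single (hP i) (coproductIsCoproduct Y) (f ≫ σ)
  refine ⟨J, fun i => g i ≫ (e i).hom, ?_⟩
  rw [← Category.comp_id f, ← hσ, ← Category.assoc, hg, Preadditive.sum_comp]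
  exact Finset.sum_congr rfl fun i _ => by rw [Category.assoc, hθ, Category.assoc]

end SmallSingle

/-! ### Colimits of modules are computed objectwise. -/

section LinMod

variable {K : Type k} [CommRing K] {C : Type w} [Category.{v} C] [Preadditive C] [Linear K C]

lemma isLinearPresheaf_of_jointlyEpi {ι : Type*} {F : Cᵒᵖ ⥤ ModuleCat.{v} K}
    (H : ι → Cᵒᵖ ⥤ ModuleCat.{v} K) (p : ∀ j, H j ⟶ F)
    (hp : ∀ (X : Cᵒᵖ) (Z : ModuleCat.{v} K) (a b : F.obj X ⟶ Z),
      (∀ j, (p j).app X ≫ a = (p j).app X ≫ b) → a = b)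
    (h : ∀ j, isLinearPresheaf K C (H j)) :
    isLinearPresheaf K C F := by
  refine ⟨⟨fun {X Y f g} => hp _ _ _ _ fun j => ?_⟩, fun X Y r f => hp _ _ _ _ fun j => ?_⟩
  · have := (h j).1
    rw [← (p j).naturality, Preadditive.comp_add, ← (p j).naturality, ← (p j).naturality,
      (H j).map_add, Preadditive.add_comp]
  · rw [← (p j).naturality, Linear.comp_smul, ← (p j).naturality, (h j).2, Linear.smul_comp]

instance (J : Type*) [Category* J] [HasColimitsOfShape J (ModuleCat.{v} K)] :
    (isLinearPresheaf K C).IsClosedUnderColimitsOfShape J := ⟨by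
  rintro F ⟨p⟩
  refine isLinearPresheaf_of_jointlyEpi (fun j : J => p.diag.obj j)
    (fun j => p.ι.app j) ?_ (fun j => p.prop_diag_obj j)
  intro X Z a b hab
  exact (isColimitOfPreserves ((evaluation _ _).obj X) p.isColimit).hom_ext hab⟩

instance : HasCoproducts.{v} (LinMod K C) := fun _ => inferInstance

variable (K C) in
/-- The value of a module at an object. -/
def evalLin (X : C) : LinMod K C ⥤ ModuleCat.{v} K :=
  (isLinearPresheaf K C).ι ⋙ (evaluation _ _).obj (op X)

instance (X : C) (J : Type*) [Category* J] [HasColimitsOfShape J (ModuleCat.{v} K)] :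
    PreservesColimitsOfShape J (evalLin K C X) := by
  unfold evalLin
  infer_instance

lemma evalLin_surjective {M N : LinMod K C} (f : M ⟶ N) [Epi f] (X : C) :
    Function.Surjective (f.hom.app (op X)) :=
  (ModuleCat.epi_iff_surjective _).1 (inferInstanceAs (Epi ((evalLin K C X).map f)))

lemma exists_sum_of_isColimit_cofan {I : Type v} {X : I → ModuleCat.{v} K} {c : Cofan X}
    (hc : IsColimit c)
    (x : c.pt) : ∃ (J : Finset I) (y : ∀ i, X i), x = ∑ i ∈ J, c.inj i (y i) := by
  have h : ⨆ i, LinearMap.range (c.inj i).hom = ⊤ := by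
    let S := ⨆ i, LinearMap.range (c.inj i).hom
    have h0 : ModuleCat.ofHom S.mkQ = 0 := Cofan.IsColimit.hom_ext hc _ _ fun i => by
      ext x
      exact (Submodule.Quotient.mk_eq_zero _).2 (Submodule.mem_iSup_of_mem i ⟨x, rfl⟩)
    rw [← Submodule.ker_mkQ (⨆ i, LinearMap.range (c.inj i).hom)]
    exact LinearMap.ker_eq_top.2 (congrArg ModuleCat.Hom.hom h0)
  obtain ⟨f, hf, hfx⟩ := (Submodule.mem_iSup_iff_exists_finsupp _ _).1
    (h ▸ Submodule.mem_top : x ∈ ⨆ i, LinearMap.range (c.inj i).hom)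
  choose y hy using hf
  exact ⟨f.support, y, by
    rw [← hfx, Finsupp.sum]
    exact Finset.sum_congr rfl fun i _ => (hy i).symm⟩

end LinMod

/-! ### Elements of modules, and representables as small projective generators. -/

section Yoneda

variable {K : Type k} [CommRing K] {G : Type u} [Category.{v} G] [Abelian G] [Linear K G]
  {ι : Type v} {A : ι → G}

/-- The value of a module at the object `A i`. -/
abbrev val (M : LinMod K (InducedCategory G A)) (i : ι) : ModuleCat.{v} K :=
  M.obj.obj (op (i : InducedCategory G A))

/-- The restriction of elements of a module along a morphism. -/
def res (M : LinMod K (InducedCategory G A)) {i j : ι} (f : A j ⟶ A i) : val M i →ₗ[K] val M j :=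
  (M.obj.map (InducedCategory.homMk (X := (j : InducedCategory G A))
    (Y := (i : InducedCategory G A)) f).op).hom

/-- The action of a morphism of modules on elements. -/
def appl {M N : LinMod K (InducedCategory G A)} (φ : M ⟶ N) (i : ι) : val M i →ₗ[K] val N i :=
  (φ.hom.app (op (i : InducedCategory G A))).hom

variable {M N : LinMod K (InducedCategory G A)}

lemma res_id (i : ι) (m : val M i) : res M (𝟙 (A i)) m = m :=
  congrArg (fun f => f.hom m) (M.obj.map_id (op (i : InducedCategory G A)))

lemma res_res {i j l : ι} (f : A j ⟶ A i) (g : A l ⟶ A j) (m : val M i) :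
    res M g (res M f m) = res M (g ≫ f) m :=
  (congrArg (fun f => f.hom m) (M.obj.map_comp
    (InducedCategory.homMk (X := (j : InducedCategory G A))
      (Y := (i : InducedCategory G A)) f).op
    (InducedCategory.homMk (X := (l : InducedCategory G A))
      (Y := (j : InducedCategory G A)) g).op)).symm

lemma res_add {i j : ι} (f g : A j ⟶ A i) (m : val M i) :
    res M (f + g) m = res M f m + res M g m :=
  have := M.property.1
  congrArg (fun f => f.hom m) (M.obj.map_add
    (f := (InducedCategory.homMk (X := (j : InducedCategory G A))
      (Y := (i : InducedCategory G A)) f).op)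
    (g := (InducedCategory.homMk (X := (j : InducedCategory G A))
      (Y := (i : InducedCategory G A)) g).op))

lemma res_smul {i j : ι} (r : K) (f : A j ⟶ A i) (m : val M i) :
    res M (r • f) m = r • res M f m :=
  congrArg (fun f => f.hom m) (M.property.2 r
    (InducedCategory.homMk (X := (j : InducedCategory G A))
      (Y := (i : InducedCategory G A)) f))

lemma res_zero {i j : ι} (m : val M i) : res M (0 : A j ⟶ A i) m = 0 := by
  simpa using res_smul (0 : K) (0 : A j ⟶ A i) m

lemma appl_res (φ : M ⟶ N) {i j : ι} (f : A j ⟶ A i) (m : val M i) :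
    appl φ j (res M f m) = res N f (appl φ i m) :=
  congrArg (fun f => f.hom m) (φ.hom.naturality
    (InducedCategory.homMk (X := (j : InducedCategory G A))
      (Y := (i : InducedCategory G A)) f).op)

lemma appl_comp {L : LinMod K (InducedCategory G A)} (φ : M ⟶ N) (ψ : N ⟶ L) (i : ι)
    (m : val M i) : appl (φ ≫ ψ) i m = appl ψ i (appl φ i m) := rfl

lemma appl_ext {φ ψ : M ⟶ N} (h : ∀ i m, appl φ i m = appl ψ i m) : φ = ψ :=
  ObjectProperty.hom_ext _ (NatTrans.ext (funext fun X => ModuleCat.hom_ext (LinearMap.ext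
    fun m => h X.unop m)))

/-- A morphism of modules defined by compatible linear maps. -/
def mkHom (φ : ∀ i, val M i →ₗ[K] val N i)
    (h : ∀ ⦃i j : ι⦄ (f : A j ⟶ A i) (m : val M i), φ j (res M f m) = res N f (φ i m)) : M ⟶ N :=
  ObjectProperty.homMk
    { app X := ModuleCat.ofHom (φ X.unop)
      naturality _ _ f := ModuleCat.hom_ext (LinearMap.ext fun m => h f.unop.hom m) }

variable (K) in
/-- A morphism to `X` as an element of the module represented by `X`. -/
def homElt {X : G} {i : ι} (g : A i ⟶ X) : val ((restrictedYoneda K A).obj X) i := g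

lemma homElt_injective {X : G} {i : ι} {g g' : A i ⟶ X} (h : homElt K g = homElt K g') :
    g = g' := h

lemma homElt_surjective {X : G} {i : ι} (y : val ((restrictedYoneda K A).obj X) i) :
    ∃ g : A i ⟶ X, homElt K g = y := ⟨y, rfl⟩

lemma homElt_zero {X : G} {i : ι} : homElt K (0 : A i ⟶ X) = 0 := rfl

lemma res_homElt {X : G} {i j : ι} (f : A j ⟶ A i) (g : A i ⟶ X) :
    res _ f (homElt K g) = homElt K (f ≫ g) := rfl

lemma appl_map_homElt {X Y : G} (f : X ⟶ Y) (i : ι) (g : A i ⟶ X) :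
    appl ((restrictedYoneda K A).map f) i (homElt K g) = homElt K (g ≫ f) := rfl

/-- The morphism from a representable module attached to an element. -/
def pointHom {i : ι} (m : val M i) : (restrictedYoneda K A).obj (A i) ⟶ M :=
  mkHom (fun j =>
    { toFun := fun f : A j ⟶ A i => res M f m
      map_add' := fun f g => res_add f g m
      map_smul' := fun r f => res_smul r f m }) fun _ _ f g => (res_res g f m).symm

/-- The element attached to a morphism from a representable module. -/
def pt {i : ι} (x : (restrictedYoneda K A).obj (A i) ⟶ M) : val M i :=
  appl x i (homElt K (𝟙 (A i)))

lemma pt_pointHom {i : ι} (m : val M i) : pt (pointHom m) = m := res_id i m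

lemma pt_comp {i : ι} (x : (restrictedYoneda K A).obj (A i) ⟶ M) (φ : M ⟶ N) :
    pt (x ≫ φ) = appl φ i (pt x) := rfl

lemma appl_homElt {i j : ι} (x : (restrictedYoneda K A).obj (A i) ⟶ M) (f : A j ⟶ A i) :
    appl x j (homElt K f) = res M f (pt x) := by
  rw [pt, ← appl_res, res_homElt, Category.comp_id]

lemma pt_map_comp {i j : ι} (x : (restrictedYoneda K A).obj (A i) ⟶ M) (f : A j ⟶ A i) :
    pt ((restrictedYoneda K A).map f ≫ x) = res M f (pt x) := by
  rw [pt, appl_comp, appl_map_homElt, Category.id_comp, appl_homElt]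

lemma pt_injective {i : ι} {x y : (restrictedYoneda K A).obj (A i) ⟶ M} (h : pt x = pt y) :
    x = y :=
  appl_ext fun j m => by
    obtain ⟨f, rfl⟩ := homElt_surjective m
    rw [appl_homElt, appl_homElt, h]

lemma pt_zero {i : ι} : pt (0 : (restrictedYoneda K A).obj (A i) ⟶ M) = 0 := rfl

lemma pt_add {i : ι} (x y : (restrictedYoneda K A).obj (A i) ⟶ M) : pt (x + y) = pt x + pt y := rfl

lemma pt_sum {i : ι} {I : Type*} (J : Finset I) (x : I → ((restrictedYoneda K A).obj (A i) ⟶ M)) :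
    pt (∑ k ∈ J, x k) = ∑ k ∈ J, pt (x k) := by
  classical
  induction J using Finset.induction_on with
  | empty => simp [pt_zero]
  | insert a s ha ih => rw [Finset.sum_insert ha, Finset.sum_insert ha, pt_add, ih]

instance (i : ι) : Projective ((restrictedYoneda K A).obj (A i)) where
  factors x e _ := by
    obtain ⟨m, hm⟩ := evalLin_surjective e (i : InducedCategory G A) (pt x)
    refine ⟨pointHom m, pt_injective ?_⟩
    rw [pt_comp, pt_pointHom]
    exact hm

lemma eq_zero_of_points (f : M ⟶ N)
    (h : ∀ i (x : (restrictedYoneda K A).obj (A i) ⟶ M), x ≫ f = 0) : f = 0 :=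
  appl_ext fun i m => by
    have := congrArg pt (h i (pointHom m))
    rwa [pt_comp, pt_pointHom] at this

lemma isSmallObject_restrictedYoneda (i : ι) :
    IsSmallObject.{v} ((restrictedYoneda K A).obj (A i)) := by
  intro I X c hc f
  have hc' : IsColimit (Cofan.mk c.pt c.inj) := IsColimit.ofIsoColimit hc (Cofan.ext (Iso.refl _))
  obtain ⟨J, y, hy⟩ : ∃ (J : Finset I) (y : ∀ k, val (X k) i),
      pt f = ∑ k ∈ J, appl (c.inj k) i (y k) :=
    exists_sum_of_isColimit_cofan
      (isColimitCofanMkObjOfIsColimit (evalLin K (InducedCategory G A) i) X _ hc') (pt f)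
  refine ⟨J, fun k => pointHom (y k), pt_injective ?_⟩
  rw [pt_sum, hy]
  exact Finset.sum_congr rfl fun k _ => by rw [pt_comp, pt_pointHom]

end Yoneda

/-! ### Noetherian generators and epimorphisms from a single generator. -/

section Noetherian

variable {G : Type u} [Category.{v} G] [Abelian G] {ι : Type v}

/-- A separating family of noetherian objects, closed up to isomorphism under binary direct sums
and kernels of epimorphisms. -/
structure IsNoetherianGenerating (A : ι → G) : Prop where
  nonempty : Nonempty ι
  eq_zero : ∀ ⦃X Y : G⦄ (f : X ⟶ Y), (∀ i (x : A i ⟶ X), x ≫ f = 0) → f = 0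
  exists_biprod : ∀ i j, ∃ c, Nonempty (A c ≅ A i ⊞ A j)
  noetherian : ∀ i, IsNoetherianObject (A i)
  exists_kernel : ∀ (i j : ι) (f : A i ⟶ A j), Epi f → ∃ c, Nonempty (A c ≅ kernel f)

lemma isNoetherianGenerating (A : ι → G) (hA : (ObjectProperty.ofObj A).IsSeparating)
    (h₁ : (ObjectProperty.ofObj A).isoClosure.IsClosedUnderFiniteCoproducts)
    (h₂ : ∀ i, IsNoetherianObject (A i))
    (h₃ : ∀ (i j : ι) (f : A i ⟶ A j), Epi f →
      (ObjectProperty.ofObj A).isoClosure (kernel f)) : IsNoetherianGenerating A := by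
  have key (X : G) (h : (ObjectProperty.ofObj A).isoClosure X) : ∃ c, Nonempty (A c ≅ X) := by
    obtain ⟨_, ⟨c⟩, ⟨e⟩⟩ := h
    exact ⟨c, ⟨e.symm⟩⟩
  refine ⟨?_, fun X Y f hf => hA _ _ ?_, fun i j => key _ ?_, h₂,
    fun i j f hf => key _ (h₃ i j f hf)⟩
  · obtain ⟨c, -⟩ := key _ ((ObjectProperty.ofObj A).isoClosure.prop_coproduct
      (f := fun x : Empty => x.elim) (fun x => x.elim))
    exact ⟨c⟩
  · rintro _ ⟨i⟩ x
    rw [hf i x, comp_zero]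
  · refine ObjectProperty.prop_of_isColimit _ (BinaryBiproduct.isColimit (A i) (A j)) ?_
    rintro ⟨_ | _⟩
    · exact ObjectProperty.le_isoClosure _ _ (ObjectProperty.ofObj_apply A i)
    · exact ObjectProperty.le_isoClosure _ _ (ObjectProperty.ofObj_apply A j)

/-- Choose a member with maximal image. By directedness every other member factors through that
image, so the cokernel projection kills the whole family and is zero. -/
lemma exists_epi_of_directed {A : ι → G} {V : G} [IsNoetherianObject V]
    (Φ : ∀ i, (A i ⟶ V) → Prop) (hne : ∃ i f, Φ i f)
    (hdir : ∀ i j f g, Φ i f → Φ j g →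
      ∃ c h, Φ c h ∧ (∃ a, a ≫ h = f) ∧ ∃ b, b ≫ h = g)
    (hepi : ∀ (Z : G) (g : V ⟶ Z), (∀ i f, Φ i f → f ≫ g = 0) → g = 0) :
    ∃ i f, Φ i f ∧ Epi f := by
  let s : Set (Subobject V) := {x | ∃ i f, Φ i f ∧ imageSubobject f = x}
  obtain ⟨_, ⟨i₀, f₀, hf₀, rfl⟩, hmax⟩ := WellFounded.has_min (wellFounded_gt (α := Subobject V)) s
    (by obtain ⟨i, f, hf⟩ := hne; exact ⟨_, i, f, hf, rfl⟩)
  refine ⟨i₀, f₀, hf₀, Preadditive.epi_of_cokernel_zero (hepi _ _ fun i f hf => ?_)⟩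
  obtain ⟨c, h, hh, ⟨a, ha⟩, b, rfl⟩ := hdir _ _ _ _ hf₀ hf
  have hle : imageSubobject f₀ ≤ imageSubobject h := by
    rw [← ha]
    exact imageSubobject_comp_le a h
  have heq : imageSubobject h ≤ imageSubobject f₀ := by
    by_contra hlt
    exact hmax _ ⟨c, h, hh, rfl⟩ (lt_of_le_not_ge hle hlt)
  have h0 : (imageSubobject f₀).arrow ≫ cokernel.π f₀ = 0 := by
    rw [← cancel_epi (factorThruImageSubobject f₀)]
    simp
  have h1 : h ≫ cokernel.π f₀ = 0 := by
    rw [← imageSubobject_arrow_comp h, ← Subobject.ofLE_arrow heq]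
    simp only [Category.assoc, h0, comp_zero]
  rw [Category.assoc, h1, comp_zero]

variable {A : ι → G}

/-- An epimorphism onto a noetherian object is an epimorphism on a generator mapping to its
source. -/
lemma IsNoetherianGenerating.exists_epi_comp (hA : IsNoetherianGenerating A)
    {E V : G} [IsNoetherianObject V] (p : E ⟶ V) [Epi p] :
    ∃ (i : ι) (a : A i ⟶ E), Epi (a ≫ p) := by
  obtain ⟨i, f, ⟨a, rfl⟩, hf⟩ := exists_epi_of_directed (A := A) (V := V)
    (fun i f => ∃ a, a ≫ p = f)
    (by obtain ⟨i⟩ := hA.nonempty; exact ⟨i, 0 ≫ p, 0, rfl⟩)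
    (by
      rintro i j _ _ ⟨f, rfl⟩ ⟨g, rfl⟩
      obtain ⟨c, ⟨e⟩⟩ := hA.exists_biprod i j
      exact ⟨c, _, ⟨e.hom ≫ biprod.desc f g, rfl⟩, ⟨biprod.inl ≫ e.inv, by simp⟩,
        ⟨biprod.inr ≫ e.inv, by simp⟩⟩)
    (by
      intro Z g h
      rw [← cancel_epi p, comp_zero]
      refine hA.eq_zero _ fun i x => ?_
      rw [← Category.assoc]
      exact h i _ ⟨x, rfl⟩)
  exact ⟨i, a, hf⟩

lemma IsNoetherianGenerating.isNoetherianObject_biprod (hA : IsNoetherianGenerating A)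
    (i j : ι) :
    IsNoetherianObject (A i ⊞ A j) := by
  obtain ⟨c, ⟨e⟩⟩ := hA.exists_biprod i j
  have := hA.noetherian c
  exact isNoetherianObject_of_mono e.inv

lemma IsNoetherianGenerating.isNoetherianObject_pullback (hA : IsNoetherianGenerating A)
    {i j l : ι} (f : A i ⟶ A l)
    (g : A j ⟶ A l) : IsNoetherianObject (pullback f g) := by
  have := hA.isNoetherianObject_biprod i j
  have : Mono (biprod.lift (pullback.fst f g) (pullback.snd f g)) := by
    refine Preadditive.mono_of_cancel_zero _ fun x hx => pullback.hom_ext ?_ ?_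
    · simpa using hx =≫ biprod.fst
    · simpa using hx =≫ biprod.snd
  exact isNoetherianObject_of_mono (biprod.lift (pullback.fst f g) (pullback.snd f g))

end Noetherian

/-! ### Torsion modules are those whose elements vanish locally. -/

section Torsion

variable {K : Type k} [CommRing K] {G : Type u} [Category.{v} G] [Abelian G] [Linear K G]
  {ι : Type v} {A : ι → G}

/-- By exactness of filtered colimits, `W` is the colimit of the preimages of the finite
subcoproducts. -/
lemma eq_zero_of_finite_subcoproducts [IsGrothendieckAbelian.{v} G] {α : Type v} {F : α → G}
    {W Z : G} (p : W ⟶ ∐ F) (g : W ⟶ Z)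
    (h : ∀ (V : G) (y : V ⟶ W) (I : Type v) (S : Finset I) (φ : I → α) (b : ∀ a, V ⟶ F (φ a)),
      y ≫ p = ∑ a ∈ S, b a ≫ Sigma.ι F (φ a) → y ≫ g = 0) : g = 0 := by
  classical
  have hS : IsConnected (Finset (Discrete α)) := IsFiltered.isConnected _
  refine ((CoproductsFromFiniteFiltered.isColimitFiniteSubproductsCocone
    F).pullbackOfHasExactColimitsOfShape p).hom_ext fun S => ?_
  rw [← cancel_epi (pullbackObjIso _ _ _).inv]
  suffices pullback.snd
      ((CoproductsFromFiniteFiltered.finiteSubcoproductsCocone F).ι.app S) p ≫ g = 0 by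
    simpa using! this
  refine h _ _ _ S.attach (fun a => a.1.as) (fun a => pullback.fst _ _ ≫ Sigma.π _ a) ?_
  refine pullback.condition.symm.trans ((congrArg (pullback.fst _ _ ≫ ·)
    (CoproductsFromFiniteFiltered.finiteSubcoproductsCocone_ι_app_eq_sum F S)).trans ?_)
  exact (Preadditive.comp_sum ..).trans
    (Finset.sum_congr rfl fun a _ => (Category.assoc _ _ _).symm)

section Presentation

variable [IsGrothendieckAbelian.{v} G] (M : LinMod K (InducedCategory G A))

/-- The family of the objects `A i` indexed by all elements of the values of a module. -/
abbrev presFam : (Σ i, val M i) → G := fun m => A m.1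

/-- The direct sum of the objects `A i` indexed by all elements of the values of a module. -/
abbrev presSum : G := ∐ presFam M

open Classical in
/-- The relation between a morphism to `presSum M` which factors through a finite sub-coproduct and
the element of the module it represents. -/
def Represents {j : ι} (f : A j ⟶ presSum M) (y : val M j) : Prop :=
  -- Asking for all large finite sets lets two such relations be compared on a common set.
  ∀ᶠ s : Finset (Σ i, val M i) in Filter.atTop,
    ∑ m ∈ s, (f ≫ Sigma.π (presFam M) m) ≫ Sigma.ι (presFam M) m = f ∧
    ∑ m ∈ s, res M (f ≫ Sigma.π (presFam M) m) m.2 = y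

variable {M}

lemma Represents.add {j : ι} {f g : A j ⟶ presSum M} {y z : val M j} (hf : Represents M f y)
    (hg : Represents M g z) : Represents M (f + g) (y + z) := by
  unfold Represents at *
  filter_upwards [hf, hg] with s hs ht
  simp only [Preadditive.add_comp, Finset.sum_add_distrib, res_add, hs, ht, and_self]

lemma Represents.smul {j : ι} {f : A j ⟶ presSum M} {y : val M j} (r : K)
    (hf : Represents M f y) : Represents M (r • f) (r • y) := by
  unfold Represents at *
  filter_upwards [hf] with s hs
  simp only [Linear.smul_comp, ← Finset.smul_sum, res_smul, hs, and_self]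

lemma Represents.neg {j : ι} {f : A j ⟶ presSum M} {y : val M j}
    (hf : Represents M f y) : Represents M (-f) (-y) := by
  simpa using hf.smul (-1 : K)

lemma Represents.comp {i j : ι} {f : A j ⟶ presSum M} {y : val M j}
    (hf : Represents M f y) (g : A i ⟶ A j) : Represents M (g ≫ f) (res M g y) := by
  unfold Represents at *
  filter_upwards [hf] with s hs
  refine ⟨?_, ?_⟩
  · conv_rhs => rw [← hs.1]
    simp [Preadditive.comp_sum]
  · rw [← hs.2, map_sum]
    simp only [res_res, Category.assoc]

lemma represents_zero {j : ι} : Represents M (0 : A j ⟶ presSum M) 0 := by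
  unfold Represents
  refine Filter.Eventually.of_forall fun s => ?_
  simp [res_zero]

lemma represents_sum {j : ι} {I : Type*} (s : Finset I) (f : I → (A j ⟶ presSum M))
    (hf : ∀ a ∈ s, Represents M (f a) 0) : Represents M (∑ a ∈ s, f a) 0 := by
  classical
  induction s using Finset.induction_on with
  | empty => simpa using represents_zero
  | insert a s ha ih =>
    rw [Finset.sum_insert ha, ← add_zero (0 : val M j)]
    exact (hf a (by simp)).add (ih fun b hb => hf b (by simp [hb]))

lemma represents_ι {j : ι} (y : val M j) :
    Represents M (Sigma.ι (presFam M) ⟨j, y⟩) y := by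
  classical
  unfold Represents at *
  filter_upwards [Filter.eventually_ge_atTop {(⟨j, y⟩ : Σ i, val M i)}] with s hs
  have hs : (⟨j, y⟩ : Σ i, val M i) ∈ s := by simpa using hs
  refine ⟨?_, ?_⟩
  · rw [Finset.sum_eq_single_of_mem _ hs]
    · simp
    · intro b _ hb
      rw [Sigma.ι_π_of_ne _ hb.symm, zero_comp]
  · rw [Finset.sum_eq_single_of_mem _ hs]
    · simp [res_id]
    · intro b _ hb
      rw [Sigma.ι_π_of_ne _ hb.symm, res_zero]

lemma Represents.unique {j : ι} {f : A j ⟶ presSum M} {y z : val M j} (hf : Represents M f y)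
    (hg : Represents M f z) : y = z := by
  obtain ⟨s, hs, ht⟩ := (Filter.Eventually.and hf hg).exists
  rw [← hs.2, ht.2]

variable (M)

/-- The index set of the relations between the elements of a module. -/
abbrev Relation : Type v := Σ j : ι, {f : A j ⟶ presSum M // Represents M f 0}

/-- The sum of all relations. -/
def relSum : (∐ fun r : Relation M => A r.1) ⟶ presSum M := Sigma.desc fun r => r.2.1

variable {M} in
lemma Represents.comp_π {j : ι} {f : A j ⟶ presSum M} {y : val M j} (hf : Represents M f y) :
    f ≫ cokernel.π (relSum M) = Sigma.ι (presFam M) ⟨j, y⟩ ≫ cokernel.π (relSum M) := by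
  have h : Represents M (f + -Sigma.ι (presFam M) ⟨j, y⟩) 0 := by
    simpa using hf.add (represents_ι y).neg
  have h' : f + -Sigma.ι (presFam M) ⟨j, y⟩ =
      Sigma.ι (fun r : Relation M => A r.1) ⟨j, _, h⟩ ≫ relSum M := by simp [relSum]
  rw [← sub_eq_zero, ← Preadditive.sub_comp, sub_eq_add_neg, h', Category.assoc,
    cokernel.condition, comp_zero]

/-- The canonical morphism from a module to the restricted Yoneda module of its presented
object. -/
def toPresented : M ⟶ (restrictedYoneda K A).obj (cokernel (relSum M)) :=
  mkHom (fun j =>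
    { toFun := fun m => homElt K (Sigma.ι (presFam M) ⟨j, m⟩ ≫ cokernel.π (relSum M))
      map_add' := fun m n => congrArg (homElt K)
        (((represents_ι m).add (represents_ι n)).comp_π.symm.trans
          (Preadditive.add_comp _ _ _ _ _ _))
      map_smul' := fun r m => congrArg (homElt K)
        (((represents_ι m).smul r).comp_π.symm.trans (Linear.smul_comp _ _ _ _ _ _)) })
    fun _ _ f m => congrArg (homElt K)
      (((represents_ι m).comp f).comp_π.symm.trans (Category.assoc _ _ _))

variable {M} in
/-- If an element becomes zero in the presented object, the morphisms that restrict it to zero are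
jointly epimorphic. -/
lemma eq_zero_of_toPresented_eq_zero
    (hA : ∀ ⦃X Y : G⦄ (f : X ⟶ Y), (∀ i (x : A i ⟶ X), x ≫ f = 0) → f = 0) {i : ι} (m : val M i)
    (hm : appl (toPresented M) i m = 0) {Z : G} (g : A i ⟶ Z)
    (hg : ∀ j (f : A j ⟶ A i), res M f m = 0 → f ≫ g = 0) : g = 0 := by
  classical
  have h0 : Sigma.ι (presFam M) ⟨i, m⟩ ≫ cokernel.π (relSum M) = 0 := homElt_injective (K := K) hm
  obtain ⟨W, q, _, p, hpq⟩ := (ShortComplex.exact_cokernel (relSum M)).exact_up_to_refinements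
    (Sigma.ι (presFam M) ⟨i, m⟩) h0
  dsimp at p hpq
  rw [← cancel_epi q, comp_zero]
  refine eq_zero_of_finite_subcoproducts p _ fun V y I S φ b hy => hA _ fun j x => ?_
  rw [← Category.assoc, ← Category.assoc]
  -- The same morphism represents the restriction of `m` and, being a finite sum of relations, also
  -- 0.
  refine hg j _ (Represents.unique ((represents_ι m).comp _) ?_)
  have : ((x ≫ y) ≫ q) ≫ Sigma.ι (presFam M) ⟨i, m⟩ = ∑ a ∈ S, (x ≫ b a) ≫ (φ a).2.1 := by
    rw [Category.assoc, hpq, Category.assoc, ← Category.assoc y, hy, Preadditive.sum_comp,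
      Preadditive.comp_sum]
    simp [relSum]
  rw [this]
  refine represents_sum _ _ fun a _ => ?_
  simpa using (φ a).2.2.comp (x ≫ b a)

end Presentation

variable [IsGrothendieckAbelian.{v} G]

/-- A module is torsion if and only if its elements are locally zero. -/
lemma torsion_iff (hA : IsNoetherianGenerating A) (M : LinMod K (InducedCategory G A)) :
    torsion K A M ↔ ∀ i (x : (restrictedYoneda K A).obj (A i) ⟶ M),
      ∃ (j : ι) (f : A j ⟶ A i), Epi f ∧ (restrictedYoneda K A).map f ≫ x = 0 := by
  let adj : leftAdj K A ⊣ restrictedYoneda K A := Adjunction.ofIsRightAdjoint _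
  refine ⟨fun h i x => ?_, fun h => ?_⟩
  · have h' : IsZero ((leftAdj K A).obj M) := h
    have h0 : toPresented M = 0 := (adj.homEquiv _ _).symm.injective (h'.eq_of_src _ _)
    have := hA.noetherian i
    -- The morphisms annihilating the element are directed, through direct sums, and jointly
    -- epimorphic, so noetherianity yields a single epimorphism.
    obtain ⟨j, f, hf, hf'⟩ := exists_epi_of_directed (A := A) (V := A i)
      (fun j f => res M f (pt x) = 0) ⟨i, 0, res_zero _⟩
      (by
        intro j l f g hf hg
        obtain ⟨c, ⟨e⟩⟩ := hA.exists_biprod j l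
        refine ⟨c, e.hom ≫ biprod.desc f g, ?_, ⟨biprod.inl ≫ e.inv, by simp⟩,
          ⟨biprod.inr ≫ e.inv, by simp⟩⟩
        have : e.hom ≫ biprod.desc f g = (e.hom ≫ biprod.fst) ≫ f + (e.hom ≫ biprod.snd) ≫ g := by
          rw [biprod.desc_eq]; simp
        rw [this, res_add, ← res_res, ← res_res, hf, hg, map_zero, map_zero, add_zero])
      (fun Z g hg => eq_zero_of_toPresented_eq_zero hA.eq_zero (pt x) (by rw [h0]; rfl) g hg)
    exact ⟨j, f, hf', pt_injective (by rw [pt_map_comp, hf]; rfl)⟩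
  · change IsZero ((leftAdj K A).obj M)
    rw [IsZero.iff_id_eq_zero]
    refine (adj.homEquiv _ _).injective ?_
    refine appl_ext fun i m => ?_
    suffices ∀ (Z : G) (φ : M ⟶ (restrictedYoneda K A).obj Z), appl φ i m = 0 by
      rw [this, this]
    intro Z φ
    obtain ⟨j, f, _, hf⟩ := h i (pointHom m)
    obtain ⟨g, hg⟩ := homElt_surjective (appl φ i m)
    have hm : res M f m = 0 := by
      rw [← pt_pointHom m, ← pt_map_comp, hf]
      rfl
    have h2 : homElt K (f ≫ g) = homElt K 0 := by
      rw [← res_homElt, hg, ← appl_res, hm, map_zero, homElt_zero]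
    have h3 : f ≫ g = f ≫ 0 := (homElt_injective h2).trans comp_zero.symm
    rw [← hg, (cancel_epi f).1 h3, homElt_zero]

end Torsion

/-! ### Effaceability of Ext classes in nonzero degree. -/

section Efface
open DerivedCategory HomologicalComplex Pretriangulated

variable {C : Type*} [Category* C] [Abelian C] [HasDerivedCategory.{w} C]

lemma exists_epi_comp_eq_zero_of_single {E Y : C} {m : ℤ} (hm : m ≠ 0)
    (β : (singleFunctor C 0).obj E ⟶ (singleFunctor C m).obj Y) :
    ∃ (Z : C) (p : Z ⟶ E), Epi p ∧ (singleFunctor C 0).map p ≫ β = 0 := by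
  have : CochainComplex.IsStrictlyLE ((single C (ComplexShape.up ℤ) 0).obj E) 0 := inferInstance
  obtain ⟨X', hX', s, hs, g, hβ⟩ := right_fac_of_isStrictlyLE
    (X := (single C (ComplexShape.up ℤ) 0).obj E) (Y := (single C (ComplexShape.up ℤ) m).obj Y) β 0
  have hs' : QuasiIso s := by rwa [isIso_Q_map_iff_quasiIso] at hs
  have hX1 : X'.d 0 1 = 0 := (X'.isZero_of_isStrictlyLE 0 1).eq_of_tgt _ _
  -- The effacing object is the top term of the roof. It consists of cycles, hence maps onto `E`,
  -- while `g` vanishes on it because its target lives in degree `m ≠ 0`.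
  let z : (single C (ComplexShape.up ℤ) 0).obj (X'.X 0) ⟶ X' := mkHomFromSingle (𝟙 _) (by
    rintro k (rfl : 0 + 1 = k)
    rw [Category.id_comp]; exact hX1)
  have hz : z ≫ g = 0 := by
    refine HomologicalComplex.hom_ext _ _ fun i => ?_
    by_cases hi : i = 0
    · exact (isZero_single_obj_X (ComplexShape.up ℤ) m Y i (by omega)).eq_of_tgt _ _
    · exact (isZero_single_obj_X (ComplexShape.up ℤ) 0 _ i hi).eq_of_src _ _
  obtain ⟨p, hp⟩ := (single C (ComplexShape.up ℤ) 0).map_surjective (z ≫ s)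
  refine ⟨_, p, ?_, ?_⟩
  · have hE1 : ((single C (ComplexShape.up ℤ) 0).obj E).d 0 1 = 0 := by simp
    have h1 : Epi (homologyMap s 0) := inferInstance
    have h2 : Epi (s.f 0) := by
      let L := (single C (ComplexShape.up ℤ) 0).obj E
      have : IsIso (L.homologyπ 0) := L.isIso_homologyπ (-1) 0 (by simp) (by simp [L])
      have : IsIso (L.iCycles 0) := L.isIso_iCycles 0 1 (by simp) hE1
      have h6 : Epi (cyclesMap s 0 ≫ L.homologyπ 0) := by
        rw [← homologyπ_naturality]
        infer_instance
      have h7 : Epi (cyclesMap s 0) := by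
        have : cyclesMap s 0 = (cyclesMap s 0 ≫ L.homologyπ 0) ≫ inv (L.homologyπ 0) := by simp
        rw [this]
        infer_instance
      have h8 : Epi (X'.iCycles 0 ≫ s.f 0) := by
        rw [← cyclesMap_i]
        infer_instance
      exact epi_of_epi (X'.iCycles 0) _
    have h3 : Epi ((z ≫ s).f 0) := by
      rw [comp_f]
      have : IsIso (z.f 0) := by
        simp only [z, mkHomFromSingle_f]
        infer_instance
      infer_instance
    rw [← hp] at h3
    simp only [single_map_f_self] at h3
    have h4 := (epi_comp_iff_of_epi _ _).1 h3
    exact (epi_comp_iff_of_isIso _ _).1 h4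
  · rw [hβ]
    have h5 : (singleFunctor C 0).map p = (singleToQ z : _ ⟶ Q.obj X') ≫ Q.map s := by
      rw [← singleToQ_comp, ← hp]
      rfl
    refine (congrArg (· ≫ _) h5).trans ((Category.assoc _ _ _).trans ?_)
    refine (congrArg (singleToQ z ≫ ·) (IsIso.hom_inv_id_assoc (Q.map s) (Q.map g))).trans ?_
    exact (singleToQ_comp z g).symm.trans ((congrArg singleToQ hz).trans (Q.map_zero _ _))

lemma exists_epi_comp_eq_zero {E Y : C} {n : ℤ} (hn : n ≠ 0)
    (β : (singleFunctor C 0).obj E ⟶ ((singleFunctor C 0).obj Y)⟦n⟧) :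
    ∃ (Z : C) (p : Z ⟶ E), Epi p ∧ (singleFunctor C 0).map p ≫ β = 0 := by
  let e := ((singleFunctors C).shiftIso n (-n) 0 (by simp)).app Y
  obtain ⟨Z, p, hp, h⟩ := exists_epi_comp_eq_zero_of_single (m := -n) (by omega) (β ≫ e.hom)
  exact ⟨Z, p, hp, by rwa [← cancel_mono e.hom, Category.assoc, zero_comp]⟩

end Efface

/-! ### The cone of a morphism between objects in degree 0. -/

section Cone
open DerivedCategory Pretriangulated

variable {C : Type*} [Category* C] [Abelian C] [HasDerivedCategory.{w} C]

lemma neg_distinguished {T : Type*} [Category* T] [Preadditive T] [HasZeroObject T] [HasShift T ℤ]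
    [∀ n : ℤ, (shiftFunctor T n).Additive] [Pretriangulated T] {X Y Z : T} {f : X ⟶ Y} {g : Y ⟶ Z}
    {h : Z ⟶ X⟦(1 : ℤ)⟧} (ht : Triangle.mk f g h ∈ distTriang T) :
    Triangle.mk (-f) g (-h) ∈ distTriang T :=
  isomorphic_distinguished _ ht _ (Triangle.isoMk _ _ (-Iso.refl X) (Iso.refl Y) (Iso.refl Z)
    (show (-f) ≫ 𝟙 Y = (-𝟙 X) ≫ f by simp) (show g ≫ 𝟙 Z = 𝟙 Y ≫ g by simp)
    (show (-h) ≫ (-𝟙 X)⟦(1 : ℤ)⟧' = 𝟙 Z ≫ h by simp))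

/-- If `r` is a kernel of `q`, the cone of `q` is an extension of the cokernel of `q` by the shift
of the source of `r`. -/
lemma exists_triangle_cone {R B L : C} {r : R ⟶ B} {q : B ⟶ L} (hrq : r ≫ q = 0) [Mono r]
    (hex : (ShortComplex.mk r q hrq).Exact) {D : DerivedCategory C}
    {c : (singleFunctor C 0).obj L ⟶ D} {d : D ⟶ ((singleFunctor C 0).obj B)⟦(1 : ℤ)⟧}
    (ht : Triangle.mk ((singleFunctor C 0).map q) c d ∈ distTriang _) :
    ∃ (a : ((singleFunctor C 0).obj R)⟦(1 : ℤ)⟧ ⟶ D)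
      (b : D ⟶ (singleFunctor C 0).obj (cokernel q))
      (e : (singleFunctor C 0).obj (cokernel q) ⟶ ((singleFunctor C 0).obj R)⟦(1 : ℤ)⟧⟦(1 : ℤ)⟧),
      Triangle.mk a b e ∈ distTriang _ ∧ a ≫ d = ((singleFunctor C 0).map r)⟦(1 : ℤ)⟧' := by
  have w₁ : r ≫ factorThruImage q = 0 := by
    rw [← cancel_mono (image.ι q), Category.assoc, image.fac, hrq, zero_comp]
  have w₂ : image.ι q ≫ cokernel.π q = 0 := by
    rw [← cancel_epi (factorThruImage q), image.fac_assoc, cokernel.condition, comp_zero]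
  have h₁ : (ShortComplex.mk r (factorThruImage q) w₁).ShortExact := by
    refine { exact := ?_, mono_f := ‹_›, epi_g := inferInstanceAs (Epi (factorThruImage q)) }
    let φ : ShortComplex.mk r (factorThruImage q) w₁ ⟶ ShortComplex.mk r q hrq :=
      { τ₁ := 𝟙 R, τ₂ := 𝟙 B, τ₃ := image.ι q }
    have : Epi φ.τ₁ := inferInstanceAs (Epi (𝟙 R))
    have : IsIso φ.τ₂ := inferInstanceAs (IsIso (𝟙 B))
    have : Mono φ.τ₃ := inferInstanceAs (Mono (image.ι q))
    rw [ShortComplex.exact_iff_of_epi_of_isIso_of_mono φ]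
    exact hex
  have h₂ : (ShortComplex.mk (image.ι q) (cokernel.π q) w₂).ShortExact := by
    refine { exact := ?_, mono_f := inferInstanceAs (Mono (image.ι q)),
             epi_g := inferInstanceAs (Epi (cokernel.π q)) }
    let φ : ShortComplex.mk q (cokernel.π q) (cokernel.condition q) ⟶
        ShortComplex.mk (image.ι q) (cokernel.π q) w₂ :=
      { τ₁ := factorThruImage q, τ₂ := 𝟙 L, τ₃ := 𝟙 (cokernel q) }
    have : Epi φ.τ₁ := inferInstanceAs (Epi (factorThruImage q))
    have : IsIso φ.τ₂ := inferInstanceAs (IsIso (𝟙 L))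
    have : Mono φ.τ₃ := inferInstanceAs (Mono (𝟙 (cokernel q)))
    rw [← ShortComplex.exact_iff_of_epi_of_isIso_of_mono φ]
    exact ShortComplex.exact_cokernel q
  have t₁ : Triangle.mk ((singleFunctor C 0).map (factorThruImage q)) h₁.singleδ
      (-((singleFunctor C 0).map r)⟦(1 : ℤ)⟧') ∈ distTriang _ :=
    rot_of_distTriang _ h₁.singleTriangle_distinguished
  have t₂ := h₂.singleTriangle_distinguished
  have comm : (singleFunctor C 0).map (factorThruImage q) ≫ (singleFunctor C 0).map (image.ι q) =
    (singleFunctor C 0).map q := by rw [← Functor.map_comp, image.fac]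
  -- The octahedron for epimorphism followed by monomorphism. Rotating `t₁` introduced a sign,
  -- undone by taking `-o.m₁`.
  have o := Triangulated.someOctahedron comm t₁ t₂ ht
  refine ⟨-o.m₁, o.m₃, _, neg_distinguished o.mem, ?_⟩
  exact (Preadditive.neg_comp _ _).trans ((congrArg Neg.neg o.comm₂).trans (neg_neg _))

lemma eq_zero_of_single_shift {P X : C} [Projective P]
    (f : ((singleFunctor C 0).obj P)⟦(1 : ℤ)⟧ ⟶ (singleFunctor C 0).obj X) : f = 0 := by
  let e := ((singleFunctors C).shiftIso (1 : ℤ) (-1) 0 (by simp)).app P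
  rw [← cancel_epi e.inv, comp_zero]
  refine homologyPoint_injective ?_
  exact (isZero_of_isGE _ 0 (-1) (by simp)).eq_of_tgt _ _

end Cone

/-! ### Representables in D(M) and complexes with torsion cohomology. -/

section DerivedYoneda
open DerivedCategory Pretriangulated ZeroObject

variable {K : Type k} [CommRing K] {G : Type u} [Category.{v} G] [Abelian G] [Linear K G]
  {ι : Type v} {A : ι → G}

instance : (restrictedYoneda K A).Additive where
  map_add := appl_ext fun i m => by
    obtain ⟨g, rfl⟩ := homElt_surjective m
    exact Preadditive.comp_add _ _ _ _ _ _

lemma exists_map_eq {i : ι} {X : G}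
    (x : (restrictedYoneda K A).obj (A i) ⟶ (restrictedYoneda K A).obj X) :
    ∃ g : A i ⟶ X, (restrictedYoneda K A).map g = x := by
  obtain ⟨g, hg⟩ := homElt_surjective (pt x)
  refine ⟨g, pt_injective ?_⟩
  rw [← hg, pt, appl_map_homElt, Category.id_comp]

/-- An element of the cokernel lifts to some g : A i → A l, and g factors through `q` after pullback
along `q`; a generator covering the pullback kills the element. -/
lemma torsion_cokernel [IsGrothendieckAbelian.{v} G] (hA : IsNoetherianGenerating A)
    {b l : ι} (q : A b ⟶ A l) [Epi q] :
    torsion K A (cokernel ((restrictedYoneda K A).map q)) := by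
  rw [torsion_iff hA]
  intro i x
  obtain ⟨g, hg⟩ := exists_map_eq (Projective.factorThru x (cokernel.π _))
  have := hA.noetherian i
  obtain ⟨j, a, ha⟩ := hA.exists_epi_comp (pullback.fst g q)
  refine ⟨j, _, ha, ?_⟩
  rw [← Projective.factorThru_comp x (cokernel.π _), ← hg, ← Functor.map_comp_assoc,
    Category.assoc, pullback.condition, Functor.map_comp, Functor.map_comp]
  simp

lemma torsion_of_isZero [IsGrothendieckAbelian.{v} G] (hA : IsNoetherianGenerating A)
    {M : LinMod K (InducedCategory G A)} (h : IsZero M) : torsion K A M := by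
  rw [torsion_iff hA]
  exact fun i x => ⟨i, 𝟙 _, inferInstance, h.eq_of_tgt _ _⟩

variable [HasDerivedCategory.{w'} (LinMod K (InducedCategory G A))]

variable (K A) in
/-- The functor sending an object of `G` to the module it represents, as a complex in degree `0`. -/
def derivedYoneda : G ⥤ DerivedCategory (LinMod K (InducedCategory G A)) :=
  restrictedYoneda K A ⋙ singleFunctor _ 0

lemma isSmallObject_derivedYoneda (i : ι) : IsSmallObject.{v} ((derivedYoneda K A).obj (A i)) :=
  isSmallObject_singleFunctor_obj (fun i => (restrictedYoneda K A).obj (A i))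
    (fun _ _ f h => eq_zero_of_points f h) isSmallObject_restrictedYoneda 0 i

lemma isZero_of_forall_derivedYoneda_eq_zero (X : DerivedCategory (LinMod K (InducedCategory G A)))
    (h : ∀ (n : ℤ) (i : ι) (x : (derivedYoneda K A).obj (A i) ⟶ X⟦n⟧), x = 0) : IsZero X := by
  have h0 (n : ℤ) : IsZero ((homologyFunctor (LinMod K (InducedCategory G A)) n).obj X) := by
    suffices IsZero ((homologyFunctor (LinMod K (InducedCategory G A)) 0).obj (X⟦n⟧)) from
      this.of_iso (((homologyFunctor (LinMod K (InducedCategory G A)) 0).shiftIso n 0 n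
        (by simp)).symm.app X)
    refine (IsZero.iff_id_eq_zero _).2 (eq_zero_of_points _ fun i x => ?_)
    obtain ⟨f, rfl⟩ := homologyPoint_surjective x
    rw [show homologyPoint f = 0 from (congrArg homologyPoint (h n i f)).trans homologyPoint_zero,
      zero_comp]
  have : IsIso (0 : X ⟶ 0) := by
    rw [DerivedCategory.isIso_iff]
    intro n
    exact ⟨0, (h0 n).eq_of_src _ _,
      ((homologyFunctor _ n).map_isZero (isZero_zero _)).eq_of_src _ _⟩
  exact (isZero_zero _).of_iso (asIso (0 : X ⟶ 0))

variable [IsGrothendieckAbelian.{v} G]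

lemma derivedWithCohomologyIn_torsion_iff (hA : IsNoetherianGenerating A)
    (X : DerivedCategory (LinMod K (InducedCategory G A))) :
    derivedWithCohomologyIn (torsion K A) X ↔
      ∀ (n : ℤ) (i : ι) (x : (singleFunctor _ n).obj ((restrictedYoneda K A).obj (A i)) ⟶ X),
        ∃ (j : ι) (f : A j ⟶ A i), Epi f ∧
          (singleFunctor _ n).map ((restrictedYoneda K A).map f) ≫ x = 0 := by
  refine forall_congr' fun n => ?_
  rw [torsion_iff hA]
  refine forall_congr' fun i => ⟨fun h x => ?_, fun h y => ?_⟩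
  · obtain ⟨j, f, hf, h⟩ := h (homologyPoint x)
    exact ⟨j, f, hf, homologyPoint_injective (by rw [homologyPoint_map_comp, h])⟩
  · obtain ⟨x, rfl⟩ := homologyPoint_surjective y
    obtain ⟨j, f, hf, h⟩ := h x
    exact ⟨j, f, hf, by rw [← homologyPoint_map_comp, h, homologyPoint_zero]⟩

/-- A point of `Y` dies in `Z` after one epimorphism, hence lifts to `X`, where a second one kills
it. -/
lemma derivedWithCohomologyIn_torsion_ext₂ (hA : IsNoetherianGenerating A)
    {X Y Z : DerivedCategory (LinMod K (InducedCategory G A))} {f : X ⟶ Y} {g : Y ⟶ Z}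
    {h : Z ⟶ X⟦(1 : ℤ)⟧} (ht : Triangle.mk f g h ∈ distTriang _)
    (hX : derivedWithCohomologyIn (torsion K A) X) (hZ : derivedWithCohomologyIn (torsion K A) Z) :
    derivedWithCohomologyIn (torsion K A) Y := by
  rw [derivedWithCohomologyIn_torsion_iff hA] at hX hZ ⊢
  intro n i y
  obtain ⟨j, p, hp, h₁⟩ := hZ n i (y ≫ g)
  obtain ⟨x, hx⟩ := exists_lift_of_distinguished ht _ ((Category.assoc _ _ _).trans h₁)
  obtain ⟨l, q, hq, h₂⟩ := hX n j x
  refine ⟨l, q ≫ p, epi_comp q p, ?_⟩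
  rw [Functor.map_comp, Functor.map_comp, Category.assoc, ← hx, reassoc_of% h₂, zero_comp]

lemma derivedWithCohomologyIn_single (hA : IsNoetherianGenerating A)
    {M : LinMod K (InducedCategory G A)} (h : torsion K A M) :
    derivedWithCohomologyIn (torsion K A) ((singleFunctor _ 0).obj M) := by
  intro n
  obtain hn | rfl | hn := lt_trichotomy n 0
  · exact torsion_of_isZero hA (isZero_of_isGE _ 0 n hn)
  · exact (torsion K A).prop_of_iso ((singleFunctorCompHomologyFunctorIso _ 0).symm.app M) h
  · exact torsion_of_isZero hA (isZero_of_isLE _ 0 n hn)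

end DerivedYoneda

/-! ### Killing Ext classes on kernels of epimorphisms. -/

section Lift
open DerivedCategory

variable {G : Type u} [Category.{v} G] [Abelian G] {ι : Type v} {A : ι → G}

lemma IsNoetherianGenerating.exists_shortExact (hA : IsNoetherianGenerating A) {b l : ι}
    (q : A b ⟶ A l) [Epi q] :
    ∃ (r : ι) (ρ : A r ⟶ A b) (h : ρ ≫ q = 0), (ShortComplex.mk ρ q h).ShortExact := by
  obtain ⟨r, ⟨e⟩⟩ := hA.exists_kernel _ _ q inferInstance
  refine ⟨r, e.hom ≫ kernel.ι q, by simp, ?_⟩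
  exact { exact := ShortComplex.exact_of_f_is_kernel _
            (IsKernel.isoKernel q _ (kernelIsKernel q) e rfl)
          mono_f := inferInstanceAs (Mono (e.hom ≫ kernel.ι q))
          epi_g := ‹_› }

variable [IsGrothendieckAbelian.{v} G] [HasDerivedCategory.{w} G]

lemma IsNoetherianGenerating.exists_lift_of_comp_singleδ_eq_zero (hA : IsNoetherianGenerating A)
    {k a i l : ι} {ρ : A k ⟶ A a} {p : A a ⟶ A i} {h : ρ ≫ p = 0}
    (hρ : (ShortComplex.mk ρ p h).ShortExact) {Y : G} {m : ℤ} (hm : m ≠ 0)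
    (κ : (singleFunctor G 0).obj (A k) ⟶ ((singleFunctor G 0).obj Y)⟦m⟧) (f : A l ⟶ A i)
    (hf : (singleFunctor G 0).map f ≫ hρ.singleδ ≫ κ⟦(1 : ℤ)⟧' = 0) :
    ∃ (r b : ι) (σ : A r ⟶ A b) (q : A b ⟶ A l) (w : σ ≫ q = 0)
      (_ : (ShortComplex.mk σ q w).ShortExact) (f₁ : A r ⟶ A k) (f₂ : A b ⟶ A a),
      f₁ ≫ ρ = σ ≫ f₂ ∧ f₂ ≫ p = q ≫ f ∧ (singleFunctor G 0).map f₁ ≫ κ = 0 := by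
  have : Epi p := hρ.epi_g
  have : Mono ρ := hρ.mono_f
  let ρ' : A k ⟶ pullback p f := pullback.lift ρ 0 (by simp [h])
  have w' : ρ' ≫ pullback.snd p f = 0 := pullback.lift_snd _ _ _
  have hfst : ρ' ≫ pullback.fst p f = ρ := pullback.lift_fst _ _ _
  have : Mono ρ' := mono_of_mono_fac hfst
  have hlift {W : G} (x : W ⟶ pullback p f) (hx : x ≫ pullback.snd p f = 0) :
      ∃ y : W ⟶ A k, y ≫ ρ' = x := by
    have hx' : (x ≫ pullback.fst p f) ≫ p = 0 := by
      rw [Category.assoc, pullback.condition, reassoc_of% hx, zero_comp]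
    refine ⟨hρ.exact.lift _ hx', pullback.hom_ext ?_ ?_⟩
    · rw [Category.assoc, hfst]
      exact hρ.exact.lift_f _ hx'
    · rw [Category.assoc, w', comp_zero, hx]
  have hρ' : (ShortComplex.mk ρ' (pullback.snd p f) w').ShortExact :=
    { exact := ShortComplex.exact_of_f_is_kernel _ (KernelFork.IsLimit.ofι' _ _ fun x hx =>
        ⟨(hlift x hx).choose, (hlift x hx).choose_spec⟩)
      mono_f := ‹_›
      epi_g := inferInstanceAs (Epi (pullback.snd p f)) }
  let φ : ShortComplex.mk ρ' (pullback.snd p f) w' ⟶ ShortComplex.mk ρ p h :=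
    { τ₁ := 𝟙 _, τ₂ := pullback.fst p f, τ₃ := f
      comm₁₂ := (Category.id_comp _).trans hfst.symm
      comm₂₃ := pullback.condition }
  -- The class of the pulled-back extension is the pullback of the class; its product with `κ`
  -- vanishes, so `κ` extends to the pullback.
  have hδ : hρ'.singleδ = (singleFunctor G 0).map f ≫ hρ.singleδ := by
    have := (ShortComplex.ShortExact.singleTriangle.map hρ' hρ φ).comm₃
    have h1 : ((singleFunctor G 0).map (𝟙 (A k)))⟦(1 : ℤ)⟧' = 𝟙 _ := by simp
    exact ((congrArg (hρ'.singleδ ≫ ·) h1).trans (Category.comp_id _)).symm.trans this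
  obtain ⟨β, hβ⟩ := exists_extension_of_distinguished hρ'.singleTriangle_distinguished κ
    (show hρ'.singleδ ≫ κ⟦(1 : ℤ)⟧' = 0 by rw [hδ, Category.assoc, hf])
  replace hβ : (singleFunctor G 0).map ρ' ≫ β = κ := hβ
  obtain ⟨Z, π, hπ, hπβ⟩ := exists_epi_comp_eq_zero hm β
  have := hA.isNoetherianObject_pullback p f
  -- The pullback is noetherian, so the effacing epimorphism can be taken from a generator.
  obtain ⟨b, a', ha'⟩ := hA.exists_epi_comp π
  have : Epi ((a' ≫ π) ≫ pullback.snd p f) := epi_comp _ _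
  obtain ⟨r, σ, w, hσ⟩ := hA.exists_shortExact ((a' ≫ π) ≫ pullback.snd p f)
  obtain ⟨f₁, hf₁⟩ := hlift (σ ≫ a' ≫ π) ((Category.assoc _ _ _).trans w)
  refine ⟨r, b, σ, _, w, hσ, f₁, (a' ≫ π) ≫ pullback.fst p f, ?_, ?_, ?_⟩
  · rw [← hfst, reassoc_of% hf₁]
    simp
  · simp [pullback.condition]
  · rw [← hβ, ← Functor.map_comp_assoc, hf₁, Functor.map_comp, Functor.map_comp, Category.assoc,
      Category.assoc, hπβ, comp_zero, comp_zero]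

end Lift

/-! ### Obstructions to factoring through small objects with torsion cohomology. -/

section Factorization
open DerivedCategory Pretriangulated ZeroObject

variable {K : Type k} [CommRing K] {G : Type u} [Category.{v} G] [Abelian G] [Linear K G]
  {ι : Type v} {A : ι → G} [HasDerivedCategory.{w'} (LinMod K (InducedCategory G A))]
  [IsGrothendieckAbelian.{v} G]

variable (K A) in
/-- The morphisms of the derived category of modules which factor through a small object with
torsion cohomology. -/
def FactorsThruSmall {U X : DerivedCategory (LinMod K (InducedCategory G A))} (x : U ⟶ X) : Prop :=
  ∃ (P : DerivedCategory (LinMod K (InducedCategory G A))) (a : U ⟶ P) (b : P ⟶ X),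
    derivedWithCohomologyIn (torsion K A) P ∧ IsSmallObject.{v} P ∧ a ≫ b = x

lemma FactorsThruSmall.comp {U V X Y : DerivedCategory (LinMod K (InducedCategory G A))}
    {x : U ⟶ X} (h : FactorsThruSmall K A x) (f : V ⟶ U) (g : X ⟶ Y) :
    FactorsThruSmall K A (f ≫ x ≫ g) := by
  obtain ⟨P, a, b, hP, hP', rfl⟩ := h
  exact ⟨P, f ≫ a, b ≫ g, hP, hP', by simp⟩

lemma FactorsThruSmall.shift {U X : DerivedCategory (LinMod K (InducedCategory G A))} {x : U ⟶ X}
    (h : FactorsThruSmall K A x) (n : ℤ) : FactorsThruSmall K A (x⟦n⟧') := by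
  obtain ⟨P, a, b, hP, hP', rfl⟩ := h
  exact ⟨P⟦n⟧, a⟦n⟧', b⟦n⟧', (derivedWithCohomologyIn (torsion K A)).le_shift n _ hP,
    hP'.shift n, by simp⟩

lemma factorsThruSmall_zero (hA : IsNoetherianGenerating A)
    {U X : DerivedCategory (LinMod K (InducedCategory G A))} :
    FactorsThruSmall K A (0 : U ⟶ X) :=
  ⟨0, 0, 0, fun n => torsion_of_isZero hA ((homologyFunctor _ n).map_isZero (isZero_zero _)),
    .of_isZero (isZero_zero _), by simp⟩

lemma exists_triangle_cone_derivedYoneda {r b l : ι} (ρ : A r ⟶ A b) (q : A b ⟶ A l)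
    (h : ρ ≫ q = 0) (hex : (ShortComplex.mk ρ q h).ShortExact)
    {D : DerivedCategory (LinMod K (InducedCategory G A))}
    {c : (derivedYoneda K A).obj (A l) ⟶ D} {d : D ⟶ ((derivedYoneda K A).obj (A b))⟦(1 : ℤ)⟧}
    (ht : Triangle.mk ((derivedYoneda K A).map q) c d ∈ distTriang _) :
    ∃ (a : ((derivedYoneda K A).obj (A r))⟦(1 : ℤ)⟧ ⟶ D)
      (b' : D ⟶ (singleFunctor _ 0).obj (cokernel ((restrictedYoneda K A).map q)))
      (e : (singleFunctor _ 0).obj (cokernel ((restrictedYoneda K A).map q)) ⟶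
        ((derivedYoneda K A).obj (A r))⟦(1 : ℤ)⟧⟦(1 : ℤ)⟧),
      Triangle.mk a b' e ∈ distTriang _ ∧ a ≫ d = ((derivedYoneda K A).map ρ)⟦(1 : ℤ)⟧' := by
  have : Mono ρ := hex.mono_f
  exact exists_triangle_cone (r := (restrictedYoneda K A).map ρ) (q := (restrictedYoneda K A).map q)
    (by rw [← Functor.map_comp, h, Functor.map_zero])
    (hex.exact.map_of_mono_of_preservesKernel (restrictedYoneda K A) ‹_› inferInstance) ht

/-- A factorization through a small torsion object after restriction to the kernel of an epimorphism
`q : A b ⟶ A l` induces one on `A l`. -/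
lemma factorsThruSmall_of_square (hA : IsNoetherianGenerating A) {k a i r b l : ι}
    {ρ : A k ⟶ A a} {p : A a ⟶ A i}
    {X C : DerivedCategory (LinMod K (InducedCategory G A))}
    {c : (derivedYoneda K A).obj (A i) ⟶ C} {d : C ⟶ ((derivedYoneda K A).obj (A a))⟦(1 : ℤ)⟧}
    (ht : Triangle.mk ((derivedYoneda K A).map p) c d ∈ distTriang _)
    {t : ((derivedYoneda K A).obj (A k))⟦(1 : ℤ)⟧ ⟶ C}
    (hw : t ≫ d = ((derivedYoneda K A).map ρ)⟦(1 : ℤ)⟧') (y : C ⟶ X)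
    {σ : A r ⟶ A b} {q : A b ⟶ A l} {h : σ ≫ q = 0} (hq : (ShortComplex.mk σ q h).ShortExact)
    (f₁ : A r ⟶ A k) (f₂ : A b ⟶ A a) (f : A l ⟶ A i) (h₁ : f₁ ≫ ρ = σ ≫ f₂)
    (h₂ : f₂ ≫ p = q ≫ f)
    (hf : FactorsThruSmall K A (((derivedYoneda K A).map f₁)⟦(1 : ℤ)⟧' ≫ t ≫ y)) :
    FactorsThruSmall K A ((derivedYoneda K A).map f ≫ c ≫ y) := by
  have : Epi q := hq.epi_g
  obtain ⟨D, c', d', ht'⟩ := distinguished_cocone_triangle ((derivedYoneda K A).map q)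
  obtain ⟨t', b', e', hm, hw'⟩ := exists_triangle_cone_derivedYoneda σ q h hq ht'
  obtain ⟨z, hz₁, hz₂⟩ : ∃ z : D ⟶ C, c' ≫ z = (derivedYoneda K A).map f ≫ c ∧
      d' ≫ ((derivedYoneda K A).map f₂)⟦(1 : ℤ)⟧' = z ≫ d :=
    complete_distinguished_triangle_morphism _ _ ht' ht
    ((derivedYoneda K A).map f₂) ((derivedYoneda K A).map f)
    (show (derivedYoneda K A).map q ≫ (derivedYoneda K A).map f =
      (derivedYoneda K A).map f₂ ≫ (derivedYoneda K A).map p by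
        rw [← Functor.map_comp, ← Functor.map_comp, h₂])
  -- Both sides agree after `d`, so their difference lifts to a morphism S(A r)[1] → S(A i), which
  -- is zero by degree.
  have hz : t' ≫ z = ((derivedYoneda K A).map f₁)⟦(1 : ℤ)⟧' ≫ t := by
    rw [← sub_eq_zero]
    obtain ⟨ψ, hψ⟩ := exists_lift_of_distinguished₃ ht
      (t' ≫ z - ((derivedYoneda K A).map f₁)⟦(1 : ℤ)⟧' ≫ t) (by
        rw [Preadditive.sub_comp, Category.assoc, Category.assoc, ← hz₂, hw, reassoc_of% hw',
          ← Functor.map_comp, ← Functor.map_comp, ← Functor.map_comp, ← Functor.map_comp, h₁,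
          sub_self])
    have hψ0 : ψ = 0 := eq_zero_of_single_shift ψ
    rw [← hψ, hψ0, zero_comp]
  obtain ⟨P, u, s, hP, hP', hus⟩ := hf
  -- `P'` is an extension of the cokernel of S(q) by `P`. That cokernel is torsion, and small as a
  -- cone of S(A r)[1] → `D`.
  obtain ⟨P', a', b'', d'', s', ht'', hs'⟩ := exists_weak_pushout hm u s (z ≫ y)
    (by rw [reassoc_of% hz, hus])
  refine ⟨P', c' ≫ d'', s', ?_, ?_, ?_⟩
  · exact derivedWithCohomologyIn_torsion_ext₂ hA ht'' hP
      (derivedWithCohomologyIn_single hA (torsion_cokernel hA q))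
  · have hD : IsSmallObject.{v} D :=
      .ext₃ ht' (isSmallObject_derivedYoneda b) (isSmallObject_derivedYoneda l)
    have hQ := IsSmallObject.ext₃ hm ((isSmallObject_derivedYoneda r).shift 1) hD
    exact .ext₂ ht'' hP' hQ
  · rw [Category.assoc, hs', reassoc_of% hz₁]

variable [HasDerivedCategory.{w} G]

/-- A morphism from a representable module to a complex with torsion cohomology factors through a
small object with torsion cohomology on the kernel of an obstruction of arbitrary large degree. -/
lemma exists_obstruction (hA : IsNoetherianGenerating A) (n : ℕ) (m : ℤ) (hm : m = n + 1) (i : ι)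
    (X : DerivedCategory (LinMod K (InducedCategory G A)))
    (hX : derivedWithCohomologyIn (torsion K A) X) (x : (derivedYoneda K A).obj (A i) ⟶ X) :
    ∃ (k : ι) (κ : (singleFunctor G 0).obj (A i) ⟶ ((singleFunctor G 0).obj (A k))⟦m⟧),
      ∀ (l : ι) (f : A l ⟶ A i), (singleFunctor G 0).map f ≫ κ = 0 →
        FactorsThruSmall K A ((derivedYoneda K A).map f ≫ x) := by
  induction n generalizing m i X with
  | zero =>
    obtain rfl : m = 1 := by simpa using hm
    obtain ⟨a, p, hp, hpx⟩ := (derivedWithCohomologyIn_torsion_iff hA X).1 hX 0 i x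
    replace hpx : (derivedYoneda K A).map p ≫ x = 0 := hpx
    obtain ⟨k, ρ, h, hρ⟩ := hA.exists_shortExact p
    refine ⟨k, hρ.singleδ, fun l f hf => ?_⟩
    obtain ⟨ψ, hψ⟩ := exists_lift_of_distinguished₃ hρ.singleTriangle_distinguished
      ((singleFunctor G 0).map f) hf
    obtain ⟨g, rfl⟩ := (singleFunctor G 0).map_surjective ψ
    obtain rfl : g ≫ p = f := (singleFunctor G 0).map_injective
      (((singleFunctor G 0).map_comp _ _).trans hψ)
    rw [Functor.map_comp, Category.assoc, hpx, comp_zero]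
    exact factorsThruSmall_zero hA
  | succ n ih =>
    obtain ⟨a, p, hp, hpx⟩ := (derivedWithCohomologyIn_torsion_iff hA X).1 hX 0 i x
    replace hpx : (derivedYoneda K A).map p ≫ x = 0 := hpx
    obtain ⟨k, ρ, h, hρ⟩ := hA.exists_shortExact p
    obtain ⟨C, c, d, ht⟩ := distinguished_cocone_triangle ((derivedYoneda K A).map p)
    obtain ⟨t, -, -, -, htd⟩ := exists_triangle_cone_derivedYoneda ρ p h hρ ht
    -- The restriction `t ≫ y` of this extension to S(A k)[1], once desuspended, is the morphism to
    -- which induction applies.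
    obtain ⟨y, rfl⟩ := exists_desc_of_distinguished ht x hpx
    let e := (shiftFunctorCompIsoId (DerivedCategory (LinMod K (InducedCategory G A)))
      (-1 : ℤ) 1 (by simp)).app X
    obtain ⟨z, hz⟩ : ∃ z : (derivedYoneda K A).obj (A k) ⟶ X⟦(-1 : ℤ)⟧,
        z⟦(1 : ℤ)⟧' = (t ≫ y) ≫ e.inv := Functor.map_surjective _ _
    obtain ⟨k', κ, hκ⟩ := ih (n + 1) rfl k (X⟦(-1 : ℤ)⟧)
      ((derivedWithCohomologyIn (torsion K A)).le_shift (-1) _ hX) z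
    let e' := (shiftFunctorAdd' (DerivedCategory G) ((n : ℤ) + 1) 1 m
      (by push_cast at hm; omega)).app ((singleFunctor G 0).obj (A k'))
    -- The Yoneda product of the extension class with the obstruction on the kernel.
    refine ⟨k', (hρ.singleδ ≫ κ⟦(1 : ℤ)⟧') ≫ e'.inv, fun l f hf => ?_⟩
    rw [← Category.assoc, ← zero_comp (f := e'.inv), cancel_mono] at hf
    obtain ⟨r, b, σ, q, w, hσ, f₁, f₂, h₁, h₂, hf₁⟩ :=
      hA.exists_lift_of_comp_singleδ_eq_zero hρ (by omega) κ f hf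
    refine factorsThruSmall_of_square hA ht htd y hσ f₁ f₂ f h₁ h₂ ?_
    have := ((hκ r f₁ hf₁).shift 1).comp (𝟙 _) e.hom
    rw [Functor.map_comp, hz] at this
    simpa using! this

end Factorization

end CptGen

end

theorem mainTheorem4 {K : Type k} [CommRing K] {G : Type u} [Category.{v} G] [Abelian G]
    [Linear K G] [IsGrothendieckAbelian.{v} G] [HasDerivedCategory.{w} G]
    {ι : Type v} (A : ι → G) (hA : (ObjectProperty.ofObj A).IsSeparating)
    [HasDerivedCategory.{w'} (CptGen.LinMod K (InducedCategory G A))]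
    (h₁ : (ObjectProperty.ofObj A).isoClosure.IsClosedUnderFiniteCoproducts)
    (h₂ : ∀ i, IsNoetherianObject (A i))
    (h₃ : ∀ (i j : ι) (f : A i ⟶ A j), Epi f →
      (ObjectProperty.ofObj A).isoClosure (kernel f))
    (h₄ : ∀ i, ∃ N : ℕ, 0 < N ∧ ∀ (j : ι)
      (f : (DerivedCategory.singleFunctor G 0).obj (A i) ⟶
        (shiftFunctor (DerivedCategory G) (N : ℤ)).obj
          ((DerivedCategory.singleFunctor G 0).obj (A j))), f = 0) :
    CptGen.SatisfiesG1
      (T := (CptGen.derivedWithCohomologyIn (CptGen.torsion K A)).FullSubcategory)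
      (fun P => CptGen.IsCompactObject.{v} P.obj) := by
  have hA' := CptGen.isNoetherianGenerating A hA h₁ h₂ h₃
  intro X
  refine ⟨fun hX P _ j f => ((shiftFunctor _ j).map_isZero hX).eq_of_tgt _ _, fun h => ?_⟩
  let I := (CptGen.derivedWithCohomologyIn (CptGen.torsion K A)).ι
  suffices IsZero (I.obj X) from
    (IsZero.iff_id_eq_zero X).2 (I.map_injective (this.eq_of_src _ _))
  refine CptGen.isZero_of_forall_derivedYoneda_eq_zero _ fun n i x => ?_
  obtain ⟨N, hN, h₄⟩ := h₄ i
  -- Stage `N - 1` has its obstruction in degree `N`, where it vanishes by hypothesis; positivity of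
  -- `N` makes the natural subtraction exact.
  obtain ⟨k, κ, hκ⟩ := CptGen.exists_obstruction hA' (N - 1) N (by omega) i
    ((shiftFunctor _ n).obj (I.obj X))
    ((CptGen.derivedWithCohomologyIn (CptGen.torsion K A)).le_shift n _ X.property) x
  obtain ⟨P, a, b, hP, hP', hab⟩ := hκ i (𝟙 _) (by rw [h₄ k κ, comp_zero])
  rw [CategoryTheory.Functor.map_id, Category.id_comp] at hab
  obtain ⟨g, hg⟩ := I.map_surjective (X := ⟨P, hP⟩) (b ≫ (I.commShiftIso n).inv.app X)
  rw [h _ hP'.isCompactObject n g, Functor.map_zero] at hg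
  have hb : b = 0 := by
    rw [← cancel_mono ((I.commShiftIso n).inv.app X), zero_comp]
    exact hg.symm
  rw [← hab, hb, comp_zero]
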